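/- Let $a,b,c\in\mathbb{R}$ satisfy either ($c=0$ and $a\neq b$) or ($c>0$ and $a<b$). Let $J_\nu(z)=\sum_{n\ge 0}\frac{(-1)^n}{n!\,\Gamma(n+\nu+1)}\left(\frac z2\right)^{2n+\nu}$ be the Bessel function of the first kind, and put $$N_\nu(z)=az^2J_\nu''(z)+bzJ_\nu'(z)+cJ_\nu(z),\qquad Q(x)=ax(x-1)+bx+c.$$ Let $\nu_0$ be the largest real root of $Q$, let $\nu\ge\max\{0,\nu_0\}$ (only $\nu\ge 0$ is required if $Q$ has no real root), and assume $Q(\nu)\neq 0$. Consider the normalized functions $$f_\nu(z)=\left[\tfrac{2^\nu\Gamma(\nu+1)}{Q(\nu)}N_\nu(z)\right]^{1/\nu}\ (\nu\ne 0),\quad g_\nu(z)=\tfrac{2^\nu\Gamma(\nu+1)}{Q(\nu)}z^{1-\nu}N_\nu(z),\quad h_\nu(z)=\tfrac{2^\nu\Gamma(\nu+1)}{Q(\nu)}z^{1-\frac\nu2}N_\nu(\sqrt z),$$ understood as functions analytic near the origin, with the branches of the powers that are positive for small $z>0$. For an analytic function $f$ whose Maclaurin series has radius of convergence $r_f$ and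 for $\beta\in[0,1)$, the radius of convexity of order $\beta$ is $$r^c_\beta(f)=\sup\left\{r\in(0,r_f):\ \operatorname{Re}\left(1+\frac{zf''(z)}{f'(z)}\right)>\beta\ \text{ for all } |z|<r\right\}.$$ Then, for every $\beta\in[0,1)$: (a) if $\nu\neq 0$, then $r^c_\beta(f_\nu)$ is the smallest positive root of $$1+\frac{rN_\nu''(r)}{N_\nu'(r)}+\left(\frac1\nu-1\right)\frac{rN_\nu'(r)}{N_\nu(r)}=\beta ;$$ moreover $r^c_\beta(f_\nu)<\lambda_{\nu,1}'<\lambda_{\nu,1}$, where $\lambda_{\nu,1}$ and $\lambda_{\nu,1}'$ are the smallest positive zeros of $N_\nu$ and of $N_\nu'$; (b) $r^c_\beta(g_\nu)$ is the smallest positive root of $$1+\frac{r^2N_\nu''(r)+(2-2\nu)rN_\nu'(r)+(\nu^2-\nu)N_\nu(r)}{rN_\nu'(r)+(1-\nu)N_\nu(r)}=\beta ;$$ (c) $r^c_\beta(h_\nu)$ is the smallest positive root of $$1+\frac{rN_\nu''(\sqrt r)+(3-2\nu)\sqrt r\,N_\nu'(\sqrt r)+(\nu^2-2\nu)N_\nu(\sqrt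 r)}{2\sqrt r\,N_\nu'(\sqrt r)+2(2-\nu)N_\nu(\sqrt r)}=\beta .$$ -/

import Mathlib

open Filter Topology

noncomputable section

/-- The Bessel function of the first kind of real order `ν`, as a function of a complex variable
(principal branch of the powers), by its power series. -/
def besselJ (ν : ℝ) (z : ℂ) : ℂ :=
  ∑' n : ℕ, (-1 : ℂ) ^ n / ((n.factorial : ℂ) * Complex.Gamma ((n : ℂ) + (ν : ℂ) + 1)) *
    (z / 2) ^ (2 * (n : ℂ) + (ν : ℂ))

/-- `N_ν(z) = a z² J_ν''(z) + b z J_ν'(z) + c J_ν(z)`. -/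
def besselN (a b c ν : ℝ) (z : ℂ) : ℂ :=
  (a : ℂ) * z ^ 2 * iteratedDeriv 2 (besselJ ν) z + (b : ℂ) * z * deriv (besselJ ν) z +
    (c : ℂ) * besselJ ν z

/-- The quadratic `Q(x) = a x (x - 1) + b x + c`. -/
def quadQ (a b c x : ℝ) : ℝ := a * x * (x - 1) + b * x + c

/-- The normalizing constant `2^ν Γ(ν+1) / Q(ν)`. -/
def normConst (a b c ν : ℝ) : ℂ :=
  (2 : ℂ) ^ (ν : ℂ) * Complex.Gamma ((ν : ℂ) + 1) / (quadQ a b c ν : ℂ)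

/-- `f_ν(z) = [2^ν Γ(ν+1) / Q(ν) · N_ν(z)]^{1/ν}`. -/
def normF (a b c ν : ℝ) (z : ℂ) : ℂ :=
  (normConst a b c ν * besselN a b c ν z) ^ (1 / (ν : ℂ))

/-- `g_ν(z) = 2^ν Γ(ν+1) / Q(ν) · z^{1-ν} N_ν(z)`. -/
def normG (a b c ν : ℝ) (z : ℂ) : ℂ :=
  normConst a b c ν * z ^ (1 - (ν : ℂ)) * besselN a b c ν z

/-- `h_ν(z) = 2^ν Γ(ν+1) / Q(ν) · z^{1-ν/2} N_ν(√z)`. -/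
def normH (a b c ν : ℝ) (z : ℂ) : ℂ :=
  normConst a b c ν * z ^ (1 - (ν : ℂ) / 2) * besselN a b c ν (z ^ (1 / 2 : ℂ))

/-- `F` is the analytic function on the disk `|z| < r` given by the formula `f`. A formula `f` with
(in general many-valued) complex powers determines an analytic function near the origin through
the branch that `f` takes on small positive reals (the principal one there); by the identity
theorem there is at most one such analytic function on the disk. -/
def IsAnalyticOnDisk (f : ℂ → ℂ) (r : ℝ) (F : ℂ → ℂ) : Prop :=
  DifferentiableOn ℂ F (Metric.ball 0 r) ∧ ∀ᶠ x : ℝ in 𝓝[>] 0, F (x : ℂ) = f (x : ℂ)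

/-- `Re (1 + z F''(z) / F'(z)) > β` on the disk `|z| < r`, the quotient being defined there. -/
def IsConvexOfOrderOnDisk (β : ℝ) (r : ℝ) (F : ℂ → ℂ) : Prop :=
  ∀ z ∈ Metric.ball (0 : ℂ) r,
    deriv F z ≠ 0 ∧ β < (1 + z * iteratedDeriv 2 F z / deriv F z).re

/-- The radius of convexity of order `β` of the analytic function given by `f`: the supremum of
all `r > 0` such that this function is analytic and convex of order `β` in the disk `|z| < r`. -/
def radiusOfConvexity (β : ℝ) (f : ℂ → ℂ) : ℝ :=
  sSup {r : ℝ | 0 < r ∧ ∃ F : ℂ → ℂ, IsAnalyticOnDisk f r F ∧ IsConvexOfOrderOnDisk β r F}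

end

/-! With `θ = z d/dz`, `N_ν = Q(θ) J_ν`. Writing `J_ν(z) = (z/2)^ν φ(z²)` and `w = z²`, `E = w
d/dw`, the operator `θ` becomes `ν + 2E`, so `N_ν(z) = (z/2)^ν Φ(z²)` with `Φ = Q(ν + 2E) φ` entire.

The proof never uses the reality of the zeros or a product expansion. It uses one property of an
entire `F` with `F(0) ≠ 0`: the function `t = -E F / F` has nonnegative Taylor coefficients at 0 and
positive linear coefficient (`PosLogDeriv`). For `φ`, Bessel's equation becomes the Riccati equation
`E t + ν t = w/4 + t²`, which determines the coefficients recursively by sums of nonnegative terms.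
The property passes from `F` to `F (s - u)` when `s > 0`, `u(0) = 0` and `u` has nonnegative
coefficients, because this adds `E u / (s - u)` to `t`. In particular it passes to `s F + 2 E F = F
(s - 2t)`. If `Q` has real roots, `Φ` is obtained from `φ` by such operators with `s = ν - root >
0`; otherwise Bessel's equation removes `E² φ` and `Φ = φ (Q(ν) - a w - 2(b - a) t)`.

Nonnegative coefficients give `|t(w)| ≤ t(|w|)` and strict growth on the positive axis, so `Re (1 -
κ t)` is controlled on each circle by its value at the positive point. Moreover `t` takes every
positive value before the first zero of `F`: a bound `|E F| ≤ τ |F|` up to a zero would force `F(0)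
= 0` by Gronwall. Hence `1 - κ t` reaches `β` at a first positive point, which is the radius.

For `g_ν` the functional is `1 - 2t` at `z²` for `F = Φ + 2 E Φ`; for `h_ν` it is `1 - t` at `z` for
`F = 2Φ + 2 E Φ`. For `f_ν`, with `p = 1 - (2/ν) t` formed from `Φ`, it is `p + 2 E p / p` at `z²`,
again 1 minus a series with nonnegative coefficients; the first zero of `p` is the square of the
first positive zero of `N_ν'`. -/

section NonnegTaylor

open scoped ComplexOrder

/-! ### Power series with nonnegative coefficients -/

/-- The Euler operator `f ↦ w f'(w)`. -/
noncomputable def eulerOp (f : ℂ → ℂ) (w : ℂ) : ℂ := w * deriv f w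

/-- `f` is analytic at the origin and its Taylor coefficients there are nonnegative reals. -/
def NonnegTaylor (f : ℂ → ℂ) : Prop :=
  AnalyticAt ℂ f 0 ∧ ∀ n, 0 ≤ iteratedDeriv n f 0

theorem eulerOp_analyticAt {f : ℂ → ℂ} {z : ℂ} (hf : AnalyticAt ℂ f z) :
    AnalyticAt ℂ (eulerOp f) z :=
  analyticAt_id.mul hf.deriv

theorem eulerOp_congr {f g : ℂ → ℂ} {z : ℂ} (h : f =ᶠ[𝓝 z] g) :
    eulerOp f =ᶠ[𝓝 z] eulerOp g := by
  filter_upwards [h.deriv] with w hw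
  simp [eulerOp, hw]

theorem iteratedDeriv_id_mul_zero {f : ℂ → ℂ} (hf : AnalyticAt ℂ f 0) (n : ℕ) :
    iteratedDeriv (n + 1) (fun w => w * f w) 0 = (n + 1) * iteratedDeriv n f 0 := by
  rw [iteratedDeriv_fun_mul (f := fun w => w) contDiffAt_id hf.contDiffAt,
    Finset.sum_eq_single 1]
  · simp [iteratedDeriv_fun_id_zero]
  · intro i _ hi
    simp [iteratedDeriv_fun_id_zero, hi]
  · simp

theorem iteratedDeriv_eulerOp_zero {f : ℂ → ℂ} (hf : AnalyticAt ℂ f 0) (n : ℕ) :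
    iteratedDeriv n (eulerOp f) 0 = n * iteratedDeriv n f 0 := by
  cases n with
  | zero => simp [eulerOp]
  | succ n =>
    unfold eulerOp
    rw [iteratedDeriv_id_mul_zero hf.deriv, iteratedDeriv_succ' (f := f)]
    simp

namespace NonnegTaylor

variable {f g : ℂ → ℂ}

theorem congr (hf : NonnegTaylor f) (h : f =ᶠ[𝓝 0] g) : NonnegTaylor g :=
  ⟨hf.1.congr h, fun n => h.iteratedDeriv_eq n ▸ hf.2 n⟩

theorem add (hf : NonnegTaylor f) (hg : NonnegTaylor g) : NonnegTaylor (fun w => f w + g w) := by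
  refine ⟨hf.1.add hg.1, fun n => ?_⟩
  rw [iteratedDeriv_fun_add hf.1.contDiffAt hg.1.contDiffAt]
  exact add_nonneg (hf.2 n) (hg.2 n)

theorem mul (hf : NonnegTaylor f) (hg : NonnegTaylor g) : NonnegTaylor (fun w => f w * g w) := by
  refine ⟨hf.1.mul hg.1, fun n => ?_⟩
  rw [iteratedDeriv_fun_mul hf.1.contDiffAt hg.1.contDiffAt]
  refine Finset.sum_nonneg fun i _ => mul_nonneg (mul_nonneg ?_ (hf.2 i)) (hg.2 _)
  exact Nat.cast_nonneg _

theorem const_mul (hf : NonnegTaylor f) {x : ℝ} (hx : 0 ≤ x) :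
    NonnegTaylor (fun w => (x : ℂ) * f w) := by
  refine ⟨analyticAt_const.mul hf.1, fun n => ?_⟩
  rw [iteratedDeriv_const_mul_field]
  exact mul_nonneg (by exact_mod_cast hx) (hf.2 n)

theorem id : NonnegTaylor (fun w => w) := by
  refine ⟨analyticAt_id, fun n => ?_⟩
  rw [iteratedDeriv_fun_id_zero]
  split_ifs <;> simp

theorem eulerOp (hf : NonnegTaylor f) : NonnegTaylor (eulerOp f) := by
  refine ⟨eulerOp_analyticAt hf.1, fun n => ?_⟩
  rw [iteratedDeriv_eulerOp_zero hf.1]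
  exact mul_nonneg (Nat.cast_nonneg _) (hf.2 n)

/-- The inverse `v` satisfies `s v = 1 + f v`. Since `f(0) = 0`, the `n`th coefficient of `f v`
involves only earlier coefficients of `v`, so nonnegativity follows by strong induction. -/
theorem inv_const_sub (hf : NonnegTaylor f) (h0 : f 0 = 0) {s : ℝ} (hs : 0 < s) :
    NonnegTaylor (fun w => ((s : ℂ) - f w)⁻¹) := by
  have hs0 : (s : ℂ) ≠ 0 := by exact_mod_cast hs.ne'
  have hv : AnalyticAt ℂ (fun w => ((s : ℂ) - f w)⁻¹) 0 :=
    (analyticAt_const.sub hf.1).inv (by simpa [h0] using hs0)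
  refine ⟨hv, fun n => ?_⟩
  set v : ℂ → ℂ := fun w => ((s : ℂ) - f w)⁻¹ with hvdef
  have hne : ∀ᶠ w in 𝓝 (0 : ℂ), (s : ℂ) - f w ≠ 0 :=
    (continuousAt_const.sub hf.1.continuousAt).eventually_ne (by simpa [h0] using hs0)
  have heq : (fun w => (s : ℂ) * v w) =ᶠ[𝓝 0] fun w => 1 + f w * v w := by
    filter_upwards [hne] with w hw
    simp only [hvdef]
    field_simp
    ring
  induction n using Nat.strong_induction_on with
  | _ n ih =>
    have h := heq.iteratedDeriv_eq n
    have hfv : AnalyticAt ℂ (fun w => f w * v w) 0 := hf.1.mul hv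
    rw [iteratedDeriv_const_mul_field,
      iteratedDeriv_fun_add analyticAt_const.contDiffAt hfv.contDiffAt,
      iteratedDeriv_fun_mul hf.1.contDiffAt hv.contDiffAt, iteratedDeriv_const] at h
    have hpos : 0 ≤ (s : ℂ) * iteratedDeriv n v 0 := by
      rw [h]
      refine add_nonneg (by split_ifs <;> simp) (Finset.sum_nonneg fun i hi => ?_)
      rcases Nat.eq_zero_or_pos i with rfl | hi0
      · simp [h0]
      · refine mul_nonneg (mul_nonneg (Nat.cast_nonneg _) (hf.2 i)) (ih _ ?_)
        have := Finset.mem_range.1 hi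
        omega
    have : iteratedDeriv n v 0 = ((s⁻¹ : ℝ) : ℂ) * ((s : ℂ) * iteratedDeriv n v 0) := by
      push_cast
      field_simp
    rw [this]
    exact mul_nonneg (by exact_mod_cast (inv_pos.2 hs).le) hpos

/-- An analytic solution of the Riccati equation `w t' + ν t = w / 4 + t²` with `t(0) = 0`
has nonnegative Taylor coefficients. -/
theorem of_riccati {t : ℂ → ℂ} (ht : AnalyticAt ℂ t 0) (h0 : t 0 = 0) {ν : ℝ} (hν : 0 ≤ ν)
    (h : ∀ᶠ w in 𝓝 0, _root_.eulerOp t w + ν * t w = (4⁻¹ : ℝ) * w + t w * t w) :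
    NonnegTaylor t := by
  refine ⟨ht, fun n => ?_⟩
  induction n using Nat.strong_induction_on with
  | _ n ih =>
    rcases Nat.eq_zero_or_pos n with rfl | hn
    · simp [h0]
    have h1 := EventuallyEq.iteratedDeriv_eq n h
    have hid : AnalyticAt ℂ (fun w : ℂ => ((4⁻¹ : ℝ) : ℂ) * w) 0 :=
      analyticAt_const.mul analyticAt_id
    have hνt : AnalyticAt ℂ (fun w : ℂ => (ν : ℂ) * t w) 0 := analyticAt_const.mul ht
    have htt : AnalyticAt ℂ (fun w : ℂ => t w * t w) 0 := ht.mul ht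
    rw [iteratedDeriv_fun_add (eulerOp_analyticAt ht).contDiffAt hνt.contDiffAt,
      iteratedDeriv_fun_add hid.contDiffAt htt.contDiffAt,
      iteratedDeriv_fun_mul ht.contDiffAt ht.contDiffAt, iteratedDeriv_const_mul_field,
      iteratedDeriv_eulerOp_zero ht] at h1
    -- On the left of the Riccati equation the `n`th derivative at 0 is `(n + ν) t⁽ⁿ⁾(0)`. On the
    -- right, the terms of `t²` with `i = 0` or `i = n` contain `t(0) = 0`, so only lower
    -- derivatives remain.
    have hpos : 0 ≤ (((n : ℝ) + ν : ℝ) : ℂ) * iteratedDeriv n t 0 := by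
      have : (((n : ℝ) + ν : ℝ) : ℂ) * iteratedDeriv n t 0 =
          n * iteratedDeriv n t 0 + ν * iteratedDeriv n t 0 := by push_cast; ring
      rw [this, h1]
      refine add_nonneg ((id.const_mul (by norm_num)).2 n) (Finset.sum_nonneg fun i hi => ?_)
      rcases Nat.eq_zero_or_pos i with rfl | hi0
      · simp [h0]
      have hi1 := Finset.mem_range.1 hi
      rcases (Nat.lt_succ_iff.1 hi1).eq_or_lt with rfl | hlt
      · simp [h0]
      · exact mul_nonneg (mul_nonneg (Nat.cast_nonneg _) (ih i hlt)) (ih _ (by omega))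
    have hnν : 0 < (n : ℝ) + ν := by
      have : (0 : ℝ) < n := by exact_mod_cast hn
      linarith
    have hne : (((n : ℝ) + ν : ℝ) : ℂ) ≠ 0 := by exact_mod_cast hnν.ne'
    have : iteratedDeriv n t 0 =
        ((((n : ℝ) + ν)⁻¹ : ℝ) : ℂ) * ((((n : ℝ) + ν : ℝ) : ℂ) * iteratedDeriv n t 0) := by
      rw [Complex.ofReal_inv, inv_mul_cancel_left₀ hne]
    rw [this]
    exact mul_nonneg (by exact_mod_cast (inv_pos.2 hnν).le) hpos

section Ball

variable {y : ℝ}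

/-- In the order of `ComplexOrder`, `0 ≤ z` includes that `z` is real. -/
theorem coe_re_iteratedDeriv (hf : NonnegTaylor f) (n : ℕ) :
    (((iteratedDeriv n f 0).re : ℝ) : ℂ) = iteratedDeriv n f 0 :=
  (Complex.eq_re_of_ofReal_le (r := 0) (by simpa using hf.2 n)).symm

theorem re_iteratedDeriv_nonneg (hf : NonnegTaylor f) (n : ℕ) :
    0 ≤ (iteratedDeriv n f 0).re :=
  (Complex.nonneg_iff.1 (hf.2 n)).1

/-- The Taylor series along the nonnegative real axis. -/
theorem hasSum_ofReal (hf : NonnegTaylor f) (hd : DifferentiableOn ℂ f (Metric.ball 0 y)) {x : ℝ}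
    (hx : 0 ≤ x) (hxy : x < y) :
    HasSum (fun n : ℕ =>
      (((n.factorial : ℝ)⁻¹ * x ^ n * (iteratedDeriv n f 0).re : ℝ) : ℂ)) (f x) := by
  have h := Complex.hasSum_taylorSeries_on_ball hd (z := x)
    (by simpa [abs_of_nonneg hx] using hxy)
  have e (n : ℕ) : (((n.factorial : ℝ)⁻¹ * x ^ n * (iteratedDeriv n f 0).re : ℝ) : ℂ) =
      (n.factorial : ℂ)⁻¹ • ((x : ℂ) - 0) ^ n • iteratedDeriv n f 0 := by
    push_cast
    rw [coe_re_iteratedDeriv hf]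
    simp [mul_assoc]
  simp only [e]
  exact h

theorem hasSum_re (hf : NonnegTaylor f) (hd : DifferentiableOn ℂ f (Metric.ball 0 y)) {x : ℝ}
    (hx : 0 ≤ x) (hxy : x < y) :
    HasSum (fun n : ℕ => (n.factorial : ℝ)⁻¹ * x ^ n * (iteratedDeriv n f 0).re) (f x).re := by
  exact Complex.hasSum_re (hf.hasSum_ofReal hd hx hxy)

theorem coe_re (hf : NonnegTaylor f) (hd : DifferentiableOn ℂ f (Metric.ball 0 y)) {x : ℝ}
    (hx : 0 ≤ x) (hxy : x < y) : (((f x).re : ℝ) : ℂ) = f x :=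
  (Complex.hasSum_ofReal.2 (hf.hasSum_re hd hx hxy)).unique (hf.hasSum_ofReal hd hx hxy)

theorem linear_le (hf : NonnegTaylor f) (hd : DifferentiableOn ℂ f (Metric.ball 0 y)) {x : ℝ}
    (hx : 0 ≤ x) (hxy : x < y) : (deriv f 0).re * x ≤ (f x).re := by
  have := le_hasSum (hf.hasSum_re hd hx hxy) 1 fun n _ =>
    mul_nonneg (by positivity) (hf.re_iteratedDeriv_nonneg n)
  simpa [mul_comm] using this

/-- The triangle inequality for the Taylor series: with nonnegative coefficients, the sum of the
absolute values of the terms is the series at `‖w‖`. -/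
theorem norm_le (hf : NonnegTaylor f) (hd : DifferentiableOn ℂ f (Metric.ball 0 y)) {w : ℂ}
    (hw : ‖w‖ < y) : ‖f w‖ ≤ (f (‖w‖ : ℝ)).re := by
  have h := Complex.hasSum_taylorSeries_on_ball hd (z := w) (by simpa using hw)
  rw [← h.tsum_eq]
  refine tsum_of_norm_bounded (hf.hasSum_re hd (norm_nonneg w) hw) fun n => ?_
  rw [norm_smul, norm_smul, ← hf.coe_re_iteratedDeriv, Complex.norm_real, Real.norm_of_nonneg
    (hf.re_iteratedDeriv_nonneg n)]
  simp [mul_assoc]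

/-- Every term of the series is nondecreasing on the nonnegative axis, and the linear one is
strictly increasing. -/
theorem re_lt_re (hf : NonnegTaylor f) (hd : DifferentiableOn ℂ f (Metric.ball 0 y))
    (h1 : 0 < (deriv f 0).re) {x x' : ℝ} (hx : 0 ≤ x) (hxx : x < x') (hxy : x' < y) :
    (f x).re < (f x').re := by
  refine hasSum_lt (i := 1) (fun n => ?_) ?_ (hf.hasSum_re hd hx (hxx.trans hxy))
    (hf.hasSum_re hd (hx.trans hxx.le) hxy)
  · have := hf.re_iteratedDeriv_nonneg n
    gcongr
  · simpa using mul_lt_mul_of_pos_right hxx h1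

end Ball

end NonnegTaylor

end NonnegTaylor

/-! ### Entire functions whose logarithmic derivative has signed coefficients -/

/-- The negative logarithmic derivative `-w F'(w) / F(w)`. -/
noncomputable def negLogDeriv (F : ℂ → ℂ) (w : ℂ) : ℂ := -(eulerOp F w / F w)

/-- The operator `F ↦ s F + 2 w F'`. -/
noncomputable def laguerreOp (s : ℝ) (F : ℂ → ℂ) (w : ℂ) : ℂ := s * F w + 2 * eulerOp F w

/-- An entire function, nonzero at the origin, whose negative logarithmic derivative has nonnegative
Taylor coefficients, the linear one being positive. -/
structure PosLogDeriv (F : ℂ → ℂ) : Prop where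
  diff : Differentiable ℂ F
  ne : F 0 ≠ 0
  nonneg : NonnegTaylor (negLogDeriv F)
  pos : 0 < (deriv (negLogDeriv F) 0).re

theorem Differentiable.eulerOp {F : ℂ → ℂ} (hF : Differentiable ℂ F) :
    Differentiable ℂ (eulerOp F) := by
  have : Differentiable ℂ (_root_.deriv F) := hF.contDiff.differentiable_deriv_two
  unfold _root_.eulerOp
  fun_prop

theorem Differentiable.laguerreOp {F : ℂ → ℂ} (hF : Differentiable ℂ F) (s : ℝ) :
    Differentiable ℂ (laguerreOp s F) :=
  (hF.const_mul _).add (hF.eulerOp.const_mul _)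

theorem laguerreOp_eq {F : ℂ → ℂ} {w : ℂ} (hw : F w ≠ 0) (s : ℝ) :
    laguerreOp s F w = F w * (s - 2 * negLogDeriv F w) := by
  unfold laguerreOp negLogDeriv
  field_simp
  ring

@[simp]
theorem eulerOp_zero_right (F : ℂ → ℂ) : eulerOp F 0 = 0 := by simp [eulerOp]

@[simp]
theorem negLogDeriv_zero (F : ℂ → ℂ) : negLogDeriv F 0 = 0 := by simp [negLogDeriv]

theorem eulerOp_const_mul (c : ℂ) (F : ℂ → ℂ) (w : ℂ) :
    eulerOp (fun z => c * F z) w = c * eulerOp F w := by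
  simp only [eulerOp, deriv_const_mul_field]
  ring

theorem negLogDeriv_const_mul {c : ℂ} (hc : c ≠ 0) (F : ℂ → ℂ) :
    negLogDeriv (fun z => c * F z) = negLogDeriv F := by
  funext w
  simp only [negLogDeriv, eulerOp_const_mul]
  rw [mul_div_mul_left _ _ hc]

theorem eulerOp_mul {f g : ℂ → ℂ} {w : ℂ} (hf : DifferentiableAt ℂ f w)
    (hg : DifferentiableAt ℂ g w) :
    eulerOp (fun z => f z * g z) w = eulerOp f w * g w + f w * eulerOp g w := by
  simp only [eulerOp]
  rw [deriv_fun_mul hf hg]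
  ring

theorem eulerOp_const_sub {f : ℂ → ℂ} {w : ℂ} (c : ℂ) :
    eulerOp (fun z => c - f z) w = -eulerOp f w := by
  simp [eulerOp, deriv_const_sub]

theorem negLogDeriv_differentiableOn {F : ℂ → ℂ} (hF : Differentiable ℂ F) {y : ℝ}
    (hy : ∀ w, ‖w‖ < y → F w ≠ 0) : DifferentiableOn ℂ (negLogDeriv F) (Metric.ball 0 y) :=
  (hF.eulerOp.differentiableOn.div hF.differentiableOn fun w hw => hy w (by simpa using hw)).neg

namespace PosLogDeriv

variable {F G : ℂ → ℂ}

theorem const_mul (hF : PosLogDeriv F) {c : ℂ} (hc : c ≠ 0) : PosLogDeriv (fun z => c * F z) where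
  diff := hF.diff.const_mul c
  ne := mul_ne_zero hc hF.ne
  nonneg := by rw [negLogDeriv_const_mul hc]; exact hF.nonneg
  pos := by rw [negLogDeriv_const_mul hc]; exact hF.pos

/-- The logarithmic derivative turns the product into a sum: the new factor contributes `E u / (s -
u)`, a product of two series with nonnegative coefficients. The identity is needed only near 0,
where `F` has no zeros. -/
theorem of_eq_mul (hF : PosLogDeriv F) {u : ℂ → ℂ} (hu : NonnegTaylor u) (hu0 : u 0 = 0) {s : ℝ}
    (hs : 0 < s) (hG : Differentiable ℂ G) (h : ∀ᶠ w in 𝓝 0, G w = F w * (s - u w)) :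
    PosLogDeriv G := by
  have hs0 : (s : ℂ) ≠ 0 := by exact_mod_cast hs.ne'
  have hne : ∀ᶠ w in 𝓝 (0 : ℂ), (s : ℂ) - u w ≠ 0 :=
    (continuousAt_const.sub hu.1.continuousAt).eventually_ne (by simpa [hu0] using hs0)
  have hFne : ∀ᶠ w in 𝓝 (0 : ℂ), F w ≠ 0 := hF.diff.continuous.continuousAt.eventually_ne hF.ne
  have hv : NonnegTaylor (fun w => eulerOp u w * ((s : ℂ) - u w)⁻¹) :=
    hu.eulerOp.mul (hu.inv_const_sub hu0 hs)
  have heq : (fun w => negLogDeriv F w + eulerOp u w * ((s : ℂ) - u w)⁻¹) =ᶠ[𝓝 0]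
      negLogDeriv G := by
    filter_upwards [hne, hFne, h, eulerOp_congr h, hu.1.eventually_analyticAt] with w h1 h2 h3 h4 h5
    simp only [negLogDeriv, h3, h4]
    rw [eulerOp_mul (hF.diff w) (by fun_prop (disch := exact h5.differentiableAt)),
      eulerOp_const_sub]
    field_simp
    ring
  refine ⟨hG, ?_, (hF.nonneg.add hv).congr heq, ?_⟩
  · rw [h.self_of_nhds, hu0, sub_zero]
    exact mul_ne_zero hF.ne hs0
  · rw [← heq.deriv_eq, deriv_fun_add hF.nonneg.1.differentiableAt hv.1.differentiableAt,
      Complex.add_re]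
    have := hv.re_iteratedDeriv_nonneg 1
    rw [iteratedDeriv_one] at this
    linarith [hF.pos]

theorem laguerreOp (hF : PosLogDeriv F) {s : ℝ} (hs : 0 < s) : PosLogDeriv (laguerreOp s F) := by
  refine hF.of_eq_mul (hF.nonneg.const_mul (zero_le_two (α := ℝ))) (by simp) hs
    (hF.diff.laguerreOp s) ?_
  filter_upwards [hF.diff.continuous.continuousAt.eventually_ne hF.ne] with w hw
  rw [laguerreOp_eq hw]
  simp

/-- If `‖w F'(w)‖ ≤ τ ‖F(w)‖` on a closed disk then `F` has no zero there unless `F(0) = 0`. -/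
theorem _root_.ne_zero_of_norm_eulerOp_le (hF : Differentiable ℂ F) (h0 : F 0 ≠ 0) {R τ : ℝ}
    (h : ∀ w, ‖w‖ ≤ R → ‖eulerOp F w‖ ≤ τ * ‖F w‖) {w : ℂ} (hw : ‖w‖ ≤ R) : F w ≠ 0 := by
  intro hw0
  -- Along the ray from `w` to 0, parametrized by `e^{-t}`, the derivative of `F` is `-eulerOp F`.
  -- The bound therefore reads `‖ψ'‖ ≤ τ ‖ψ‖`, and Gronwall from `ψ(0) = 0` gives `ψ = 0`, hence
  -- `F(0) = 0` in the limit.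
  set ψ : ℝ → ℂ := fun t => F ((Real.exp (-t) : ℝ) * w) with hψ
  have hd (t : ℝ) : HasDerivAt ψ (-eulerOp F ((Real.exp (-t) : ℝ) * w)) t := by
    have h1 : HasDerivAt (fun t : ℝ => ((Real.exp (-t) : ℝ) : ℂ) * w)
        (((Real.exp (-t) * -1 : ℝ) : ℂ) * w) t :=
      (((hasDerivAt_neg t).exp).ofReal_comp).mul_const w
    have h2 := (hF ((Real.exp (-t) : ℝ) * w)).hasDerivAt.comp t h1
    refine h2.congr_deriv ?_
    simp only [eulerOp]
    push_cast
    ring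
  have hz (t : ℝ) (ht : 0 ≤ t) : ψ t = 0 := by
    have := norm_le_gronwallBound_of_norm_deriv_right_le (f := ψ) (δ := 0) (K := τ) (ε := 0)
      (a := 0) (b := t) (fun x _ => (hd x).continuousAt.continuousWithinAt)
      (fun x _ => (hd x).hasDerivWithinAt) (by simp [hψ, hw0]) (fun x hx => by
        rw [norm_neg, add_zero]
        refine h _ ?_
        rw [norm_mul, Complex.norm_real, Real.norm_of_nonneg (Real.exp_pos _).le]
        have : Real.exp (-x) ≤ 1 := Real.exp_le_one_iff.2 (by linarith [hx.1])
        nlinarith [norm_nonneg w]) t ⟨ht, le_rfl⟩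
    simpa [gronwallBound_ε0_δ0] using this
  have hlim : Tendsto ψ atTop (𝓝 (F 0)) := by
    have h1 : Tendsto (fun t : ℝ => ((Real.exp (-t) : ℝ) : ℂ) * w) atTop (𝓝 0) := by
      simpa using ((Complex.continuous_ofReal.tendsto 0).comp
        (Real.tendsto_exp_neg_atTop_nhds_zero)).mul_const w
    exact (hF.continuous.tendsto 0).comp h1
  exact h0 (tendsto_nhds_unique hlim
    (tendsto_const_nhds.congr' ((eventually_ge_atTop 0).mono fun t ht => (hz t ht).symm)))

theorem eulerOp_eq_of_ne {w : ℂ} (hw : F w ≠ 0) : eulerOp F w = -(negLogDeriv F w * F w) := by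
  rw [negLogDeriv]
  field_simp

/-- The negative logarithmic derivative takes every positive value before the first zero. -/
theorem exists_negLogDeriv_eq (hF : PosLogDeriv F) {τ : ℝ} (hτ : 0 < τ) :
    ∃ x y : ℝ, 0 < x ∧ x < y ∧ (∀ w, ‖w‖ < y → F w ≠ 0) ∧ negLogDeriv F x = τ := by
  -- A point where the value is at least `τ` is enough, by the intermediate value theorem from the
  -- value 0 at the origin.
  suffices ∃ x y : ℝ, 0 ≤ x ∧ x < y ∧ (∀ w, ‖w‖ < y → F w ≠ 0) ∧ τ ≤ (negLogDeriv F x).re by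
    obtain ⟨x, y, hx, hxy, hne, hτx⟩ := this
    have hd := negLogDeriv_differentiableOn hF.diff hne
    have hc : ContinuousOn (fun x : ℝ => (negLogDeriv F x).re) (Set.Icc 0 x) := by
      refine Complex.continuous_re.comp_continuousOn
        (hd.continuousOn.comp Complex.continuous_ofReal.continuousOn fun t ht => ?_)
      simpa [abs_of_nonneg ht.1] using ht.2.trans_lt hxy
    obtain ⟨t, ht, hte⟩ := intermediate_value_Icc hx hc (show τ ∈ _ from ⟨by simpa using hτ.le, hτx⟩)
    refine ⟨t, y, lt_of_le_of_ne ht.1 ?_, ht.2.trans_lt hxy, hne, ?_⟩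
    · rintro rfl
      simp at hte
      exact hτ.ne hte
    · rw [← hF.nonneg.coe_re hd ht.1 (ht.2.trans_lt hxy)]
      exact congrArg _ hte
  by_cases hz : ∃ w, F w = 0
  -- `w₀` is a zero of least modulus. If the value stayed below `τ` on the positive axis up to
  -- `‖w₀‖`, then `‖E F‖ ≤ τ ‖F‖` on the open disk and, by continuity, on the closed disk,
  -- contradicting `F w₀ = 0`.
  · obtain ⟨w₀, hw₀, hmin⟩ := (isClosed_singleton.preimage hF.diff.continuous :
      IsClosed (F ⁻¹' {0})).exists_infDist_eq_dist hz 0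
    have hne : ∀ w, ‖w‖ < ‖w₀‖ → F w ≠ 0 := by
      intro w hw hw0
      have := Metric.infDist_le_dist_of_mem (x := (0 : ℂ)) (show w ∈ F ⁻¹' {0} from hw0)
      rw [hmin, dist_zero_left, dist_zero_left] at this
      linarith
    by_contra! hcon
    have hd := negLogDeriv_differentiableOn hF.diff hne
    have hlt : ∀ w, ‖w‖ < ‖w₀‖ → ‖eulerOp F w‖ ≤ τ * ‖F w‖ := by
      intro w hw
      rw [eulerOp_eq_of_ne (hne w hw), norm_neg, norm_mul]
      gcongr
      exact (hF.nonneg.norm_le hd hw).trans (hcon _ _ (norm_nonneg w) hw hne).le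
    have hw₀ne : w₀ ≠ 0 := by
      rintro rfl
      exact hF.ne hw₀
    refine ne_zero_of_norm_eulerOp_le hF.diff hF.ne (R := ‖w₀‖) (τ := τ) ?_ le_rfl hw₀
    have hcl : IsClosed {w | ‖eulerOp F w‖ ≤ τ * ‖F w‖} :=
      isClosed_le hF.diff.eulerOp.continuous.norm (hF.diff.continuous.norm.const_mul τ)
    intro w hw
    have hmem : w ∈ closure (Metric.ball (0 : ℂ) ‖w₀‖) := by
      rw [closure_ball _ (norm_ne_zero_iff.2 hw₀ne)]
      simpa using hw
    exact closure_minimal (fun z hz => hlt z (by simpa using hz)) hcl hmem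
  · push Not at hz
    -- Without zeros the function is entire and dominates its linear term, so it is at least `τ` at
    -- `τ` divided by the linear coefficient; adding 1 only provides a larger disk.
    have hd := negLogDeriv_differentiableOn (y := τ / (deriv (negLogDeriv F) 0).re + 1) hF.diff
      fun w _ => hz w
    have hx : 0 ≤ τ / (deriv (negLogDeriv F) 0).re := (div_pos hτ hF.pos).le
    refine ⟨_, _, hx, lt_add_one _, fun w _ => hz w, ?_⟩
    have := hF.nonneg.linear_le hd hx (lt_add_one _)
    rwa [mul_div_cancel₀ _ hF.pos.ne'] at this

end PosLogDeriv

/-! ### The Bessel function and Bessel's equation -/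

/-- The entire function `φ_ν` with `J_ν(z) = (z/2)^ν φ_ν(z²)`. -/
noncomputable def besselEntire (ν : ℝ) (w : ℂ) : ℂ :=
  Complex.regularizedHGFun 0 {(ν : ℂ) + 1} (-4⁻¹ * w)

theorem regularizedHGFun_hasFPowerSeriesOnBall (μ : ℂ) :
    HasFPowerSeriesOnBall (Complex.regularizedHGFun 0 {μ}) (Complex.regularizedHGFunSeries 0 {μ}) 0
      ⊤ := by
  have h : (Complex.regularizedHGFunSeries 0 {μ}).radius = ⊤ :=
    Complex.radius_regularizedHGFunSeries_eq_top (by simp)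
  have := (Complex.regularizedHGFunSeries 0 {μ}).hasFPowerSeriesOnBall (by simp [h])
  rwa [h] at this

theorem regularizedHGFun_differentiable (μ : ℂ) :
    Differentiable ℂ (Complex.regularizedHGFun 0 {μ}) := fun z =>
  ((regularizedHGFun_hasFPowerSeriesOnBall μ).analyticAt_of_mem (by simp)).differentiableAt

theorem iteratedDeriv_regularizedHGFun (μ : ℂ) (n : ℕ) :
    iteratedDeriv n (Complex.regularizedHGFun 0 {μ}) 0 =
      n.factorial * Complex.regularizedHGFunCoeff 0 {μ} n := by
  have := (regularizedHGFun_hasFPowerSeriesOnBall μ).factorial_smul 1 n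
  rw [iteratedDeriv, ← this]
  simp [Complex.regularizedHGFunSeries]

theorem eq_of_iteratedDeriv_zero_eq {f g : ℂ → ℂ} (hf : Differentiable ℂ f)
    (hg : Differentiable ℂ g) (h : ∀ n, iteratedDeriv n f 0 = iteratedDeriv n g 0) : f = g := by
  funext z
  have h1 := Complex.hasSum_taylorSeries_of_entire hf 0 z
  simp only [h] at h1
  exact h1.unique (Complex.hasSum_taylorSeries_of_entire hg 0 z)

/-- Since `E` multiplies the `n`th coefficient by `n`, this is the recursion `(n + 1)(n + 1 + ν)
c_{n+1} = c_n`. The assumption `0 ≤ ν` keeps `n + 1 + ν` away from 0. -/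
theorem eulerOp_eulerOp_regularizedHGFun {ν : ℝ} (hν : 0 ≤ ν) (w : ℂ) :
    eulerOp (eulerOp (Complex.regularizedHGFun 0 {(ν : ℂ) + 1})) w +
      ν * eulerOp (Complex.regularizedHGFun 0 {(ν : ℂ) + 1}) w =
      w * Complex.regularizedHGFun 0 {(ν : ℂ) + 1} w := by
  set B := Complex.regularizedHGFun 0 {(ν : ℂ) + 1} with hB
  have hd : Differentiable ℂ B := regularizedHGFun_differentiable _
  have hne (n : ℕ) : (n : ℂ) + 1 + ν ≠ 0 := by
    have : (0 : ℝ) < n + 1 + ν := by positivity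
    exact_mod_cast this.ne'
  refine congrFun (eq_of_iteratedDeriv_zero_eq (f := fun w => eulerOp (eulerOp B) w +
    ν * eulerOp B w) (g := fun w => w * B w) (hd.eulerOp.eulerOp.add (hd.eulerOp.const_mul _))
    (differentiable_id.mul hd) fun n => ?_) w
  have hνE : Differentiable ℂ (fun w => (ν : ℂ) * eulerOp B w) := hd.eulerOp.const_mul _
  rw [iteratedDeriv_fun_add hd.eulerOp.eulerOp.contDiff.contDiffAt hνE.contDiff.contDiffAt,
    iteratedDeriv_const_mul_field, iteratedDeriv_eulerOp_zero (hd.eulerOp.analyticAt 0),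
    iteratedDeriv_eulerOp_zero (hd.analyticAt 0)]
  cases n with
  | zero => simp
  | succ n =>
    rw [iteratedDeriv_id_mul_zero (hd.analyticAt 0), hB, iteratedDeriv_regularizedHGFun,
      iteratedDeriv_regularizedHGFun, Complex.regularizedHGFunCoeff_add_one, Nat.factorial_succ]
    · have h1 := hne n
      have h2 : (n : ℂ) + 1 ≠ 0 := Nat.cast_add_one_ne_zero n
      have h3 : (ν : ℂ) + 1 + n ≠ 0 := by convert h1 using 1; ring
      simp
      field_simp
      ring
    · intro k hk h
      apply hne n
      rw [Multiset.mem_singleton] at hk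
      linear_combination h - hk

theorem besselEntire_differentiable (ν : ℝ) : Differentiable ℂ (besselEntire ν) :=
  (regularizedHGFun_differentiable _).comp (differentiable_id.const_mul _)

theorem eulerOp_comp_const_mul (c : ℂ) (f : ℂ → ℂ) (w : ℂ) :
    eulerOp (fun z => f (c * z)) w = eulerOp f (c * w) := by
  simp only [eulerOp, deriv_comp_mul_left, smul_eq_mul]
  ring

/-- Bessel's equation in the variable `w = z²`; `E` commutes with the dilation by `-1/4`. -/
theorem eulerOp_eulerOp_besselEntire {ν : ℝ} (hν : 0 ≤ ν) (w : ℂ) :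
    eulerOp (eulerOp (besselEntire ν)) w + ν * eulerOp (besselEntire ν) w =
      -4⁻¹ * w * besselEntire ν w := by
  have h : eulerOp (besselEntire ν) =
      fun z => eulerOp (Complex.regularizedHGFun 0 {(ν : ℂ) + 1}) (-4⁻¹ * z) :=
    funext fun z => eulerOp_comp_const_mul _ _ _
  rw [h, eulerOp_comp_const_mul]
  exact eulerOp_eulerOp_regularizedHGFun hν _

theorem Gamma_ofReal_add_one_ne_zero {ν : ℝ} (hν : 0 ≤ ν) : Complex.Gamma ((ν : ℂ) + 1) ≠ 0 := by
  refine Complex.Gamma_ne_zero_of_re_pos ?_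
  simp
  linarith

theorem besselEntire_zero (ν : ℝ) : besselEntire ν 0 = (Complex.Gamma ((ν : ℂ) + 1))⁻¹ := by
  have := iteratedDeriv_regularizedHGFun ((ν : ℂ) + 1) 0
  simpa [Complex.regularizedHGFunCoeff, besselEntire] using this

theorem besselEntire_posLogDeriv {ν : ℝ} (hν : 0 ≤ ν) : PosLogDeriv (besselEntire ν) := by
  set F := besselEntire ν with hF
  have hd : Differentiable ℂ F := besselEntire_differentiable ν
  have h0 : F 0 ≠ 0 := by
    rw [hF, besselEntire_zero]
    exact inv_ne_zero (Gamma_ofReal_add_one_ne_zero hν)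
  have hne : ∀ᶠ w in 𝓝 (0 : ℂ), F w ≠ 0 := hd.continuous.continuousAt.eventually_ne h0
  have ht : AnalyticAt ℂ (negLogDeriv F) 0 :=
    ((hd.eulerOp.analyticAt 0).div (hd.analyticAt 0) h0).neg
  have hric : ∀ᶠ w in 𝓝 (0 : ℂ), eulerOp (negLogDeriv F) w + ν * negLogDeriv F w =
      (4⁻¹ : ℝ) * w + negLogDeriv F w * negLogDeriv F w := by
    have hE : eulerOp F =ᶠ[𝓝 0] fun w => 0 - negLogDeriv F w * F w := by
      filter_upwards [hne] with w hw
      rw [PosLogDeriv.eulerOp_eq_of_ne hw, zero_sub]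
    filter_upwards [hne, eulerOp_congr hE, ht.eventually_analyticAt] with w hw h2 h3
    rw [eulerOp_const_sub, eulerOp_mul h3.differentiableAt (hd w)] at h2
    have h4 := eulerOp_eulerOp_besselEntire hν w
    rw [← hF, h2, PosLogDeriv.eulerOp_eq_of_ne hw] at h4
    refine mul_right_cancel₀ hw ?_
    push_cast
    linear_combination -h4
  refine ⟨hd, h0, .of_riccati ht (by simp) hν hric, ?_⟩
  -- The linear coefficients of the Riccati equation give `(1 + ν) t'(0) = 1/4`, since `t²` vanishes
  -- to second order.
  have h1 := EventuallyEq.iteratedDeriv_eq 1 hric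
  have d := ht.differentiableAt
  have e := (eulerOp_analyticAt ht).differentiableAt
  rw [iteratedDeriv_one, iteratedDeriv_one, deriv_fun_add e (by fun_prop),
    deriv_fun_add (by fun_prop) (by fun_prop), deriv_fun_mul d d, deriv_const_mul_field,
    deriv_const_mul_field, ← iteratedDeriv_one (f := eulerOp _), iteratedDeriv_eulerOp_zero ht] at h1
  simp at h1
  have h2 := congrArg Complex.re h1
  simp at h2
  nlinarith

/-- The power series of the Bessel function. -/
theorem besselJ_eq (ν : ℝ) {z : ℂ} (hz : z ≠ 0) :
    besselJ ν z = (z / 2) ^ (ν : ℂ) * besselEntire ν (z ^ 2) := by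
  unfold besselJ besselEntire Complex.regularizedHGFun FormalMultilinearSeries.sum
  simp only [Complex.regularizedHGFunSeries, FormalMultilinearSeries.ofScalars_apply_eq]
  rw [← tsum_mul_left]
  refine tsum_congr fun n => ?_
  rw [Complex.cpow_add _ _ (div_ne_zero hz two_ne_zero)]
  have h1 : (z / 2) ^ (2 * (n : ℂ)) = (z / 2) ^ (2 * n) := by
    exact_mod_cast Complex.cpow_natCast (z / 2) (2 * n)
  have h2 : (-4⁻¹ * z ^ 2) ^ n = (-1) ^ n * (z / 2) ^ (2 * n) := by
    rw [pow_mul, ← mul_pow]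
    congr 1
    ring
  rw [h1, h2]
  simp [Complex.regularizedHGFunCoeff]
  rw [show (ν : ℂ) + 1 + n = n + ν + 1 by ring]
  ring

/-! ### Iterated first-order operators and the entire factor of `N_ν` -/

theorem PosLogDeriv.exists_laguerreOp_eq_zero {F : ℂ → ℂ} (hF : PosLogDeriv F) {s : ℝ}
    (hs : 0 < s) : ∃ x : ℝ, 0 < x ∧ _root_.laguerreOp s F x = 0 := by
  obtain ⟨x, y, hx, hxy, hne, h⟩ := hF.exists_negLogDeriv_eq (half_pos hs)
  refine ⟨x, hx, ?_⟩
  rw [laguerreOp_eq (hne _ (by simpa [abs_of_pos hx] using hxy)), h]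
  push_cast
  ring

theorem eulerOp_laguerreOp {F : ℂ → ℂ} (hF : Differentiable ℂ F) (s : ℝ) (w : ℂ) :
    eulerOp (laguerreOp s F) w = s * eulerOp F w + 2 * eulerOp (eulerOp F) w := by
  rw [← eulerOp_const_mul, ← eulerOp_const_mul]
  have h : laguerreOp s F = fun z => (s : ℂ) * F z + 2 * eulerOp F z := rfl
  rw [h]
  simp only [eulerOp]
  have h1 : DifferentiableAt ℂ (fun z => (s : ℂ) * F z) w := (hF w).const_mul _
  have h2 : DifferentiableAt ℂ (fun z => 2 * (z * deriv F z)) w := (hF.eulerOp w).const_mul _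
  rw [deriv_fun_add h1 h2]
  ring

theorem laguerreOp_laguerreOp {F : ℂ → ℂ} (hF : Differentiable ℂ F) (s s' : ℝ) (w : ℂ) :
    laguerreOp s (laguerreOp s' F) w =
      s * s' * F w + 2 * (s + s') * eulerOp F w + 4 * eulerOp (eulerOp F) w := by
  rw [laguerreOp, eulerOp_laguerreOp hF, laguerreOp]
  ring

/-- The entire function `Φ` with `N_ν(z) = (z/2)^ν Φ(z²)`. -/
noncomputable def besselNEntire (a b c ν : ℝ) (w : ℂ) : ℂ :=
  a * laguerreOp ν (laguerreOp ν (besselEntire ν)) w + (b - a) * laguerreOp ν (besselEntire ν) w +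
    c * besselEntire ν w

theorem besselNEntire_differentiable (a b c ν : ℝ) : Differentiable ℂ (besselNEntire a b c ν) :=
  ((((besselEntire_differentiable ν).laguerreOp ν).laguerreOp ν |>.const_mul _).add
    (((besselEntire_differentiable ν).laguerreOp ν).const_mul _)).add
    ((besselEntire_differentiable ν).const_mul _)

/-- This is `Q(ν + 2E) φ` expanded by Taylor's formula, with `Q'(ν) = 2aν + (b - a)` and `Q''(ν)/2 =
a`. Each factorization of `Φ` is checked against this form. -/
theorem besselNEntire_eq (a b c ν : ℝ) (w : ℂ) : besselNEntire a b c ν w =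
    quadQ a b c ν * besselEntire ν w + 2 * (2 * a * ν + (b - a)) * eulerOp (besselEntire ν) w +
      4 * a * eulerOp (eulerOp (besselEntire ν)) w := by
  rw [besselNEntire, laguerreOp_laguerreOp (besselEntire_differentiable ν), laguerreOp, quadQ]
  push_cast
  ring

theorem besselNEntire_zero (a b c ν : ℝ) :
    besselNEntire a b c ν 0 = quadQ a b c ν * (Complex.Gamma ((ν : ℂ) + 1))⁻¹ := by
  rw [besselNEntire_eq, besselEntire_zero]
  simp

/-- The factor `Φ` of `N_ν` has nonnegative logarithmic Taylor coefficients and a positive zero. -/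
theorem besselNEntire_posLogDeriv {a b c ν : ℝ} (habc : (c = 0 ∧ a ≠ b) ∨ (0 < c ∧ a < b))
    (hν : 0 ≤ ν) (hν₀ : ∀ x : ℝ, quadQ a b c x = 0 → x ≤ ν) (hQ : quadQ a b c ν ≠ 0) :
    PosLogDeriv (besselNEntire a b c ν) ∧ ∃ x : ℝ, 0 < x ∧ besselNEntire a b c ν x = 0 := by
  have hB := besselEntire_posLogDeriv hν
  have hroot {x : ℝ} (hx : quadQ a b c x = 0) : 0 < ν - x := by
    refine sub_pos.2 (lt_of_le_of_ne (hν₀ x hx) ?_)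
    rintro rfl
    exact hQ hx
  have hab : a ≠ b := by
    rcases habc with h | h
    exacts [h.2, h.2.ne]
  rcases eq_or_ne a 0 with ha | ha
  -- Here `Q` is linear with root `-c/b`, and a single first-order operator suffices.
  · have hb : b ≠ 0 := by rintro rfl; exact hab ha
    have hs := hroot (x := -c / b) (by rw [quadQ, ha]; field_simp; ring)
    have hbc : (b : ℂ) ≠ 0 := by exact_mod_cast hb
    have e : besselNEntire a b c ν = fun w => b * laguerreOp (ν - -c / b) (besselEntire ν) w := by
      funext w
      rw [besselNEntire_eq, laguerreOp, quadQ, ha]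
      push_cast
      field_simp
      ring
    obtain ⟨x, hx, hx0⟩ := hB.exists_laguerreOp_eq_zero hs
    rw [e]
    exact ⟨(hB.laguerreOp hs).const_mul hbc, x, hx, by simp [hx0]⟩
  rcases le_or_gt 0 ((b - a) ^ 2 - 4 * a * c) with hdisc | hdisc
  -- Real roots `x₁, x₂` of `Q`: the factorization `Q(ν + 2E) = a (ν - x₁ + 2E)(ν - x₂ + 2E)` has
  -- both `ν - xᵢ > 0`. The sign of `a` is irrelevant, since a nonzero constant does not change the
  -- logarithmic derivative.
  · set d := √((b - a) ^ 2 - 4 * a * c) with hd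
    have hdd : d ^ 2 = (b - a) ^ 2 - 4 * a * c := Real.sq_sqrt hdisc
    have hs₁ := hroot (x := (a - b + d) / (2 * a)) (by
      rw [quadQ]; field_simp; linear_combination hdd)
    have hs₂ := hroot (x := (a - b - d) / (2 * a)) (by
      rw [quadQ]; field_simp; linear_combination hdd)
    have hac : (a : ℂ) ≠ 0 := by exact_mod_cast ha
    have e : besselNEntire a b c ν = fun w => a * laguerreOp (ν - (a - b + d) / (2 * a))
        (laguerreOp (ν - (a - b - d) / (2 * a)) (besselEntire ν)) w := by
      funext w
      have h1 : quadQ a b c ν =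
          a * ((ν - (a - b + d) / (2 * a)) * (ν - (a - b - d) / (2 * a))) := by
        rw [quadQ]; field_simp; linear_combination hdd
      have h2 : 2 * a * ν + (b - a) =
          a * ((ν - (a - b + d) / (2 * a)) + (ν - (a - b - d) / (2 * a))) := by
        field_simp; ring
      have h2' : 2 * (a : ℂ) * ν + (b - a) = ((2 * a * ν + (b - a) : ℝ) : ℂ) := by push_cast; rfl
      rw [besselNEntire_eq, laguerreOp_laguerreOp (besselEntire_differentiable ν), h2', h1, h2]
      push_cast
      ring
    obtain ⟨x, hx, hx0⟩ := (hB.laguerreOp hs₂).exists_laguerreOp_eq_zero hs₁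
    rw [e]
    exact ⟨((hB.laguerreOp hs₂).laguerreOp hs₁).const_mul hac, x, hx, by simp [hx0]⟩
  -- A negative discriminant excludes `c = 0`, and then `c > 0` forces `a > 0`.
  · have hc : 0 < c ∧ a < b := by
      rcases habc with h | h
      · rw [h.1] at hdisc
        nlinarith [sq_nonneg (b - a)]
      · exact h
    have ha0 : 0 < a := by
      by_contra! h
      nlinarith [sq_nonneg (b - a), mul_nonneg (neg_nonneg.2 h) hc.1.le]
    have hba : 0 < 2 * (b - a) := by linarith
    have hQ0 : 0 < quadQ a b c ν := by
      have : quadQ a b c ν = a * ν ^ 2 + (b - a) * ν + c := by rw [quadQ]; ring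
      rw [this]
      have : 0 ≤ (b - a) * ν := mul_nonneg (by linarith) hν
      have := hc.1
      positivity
    set t := negLogDeriv (besselEntire ν) with ht
    -- Bessel's equation replaces `4a E² φ` by `-4aν E φ - a w φ`. The `ν` terms cancel and `Φ = φ
    -- (Q(ν) - u)` remains, where `a > 0` and `b - a > 0` make the coefficients of `u` nonnegative.
    set u : ℂ → ℂ := fun w => (a : ℂ) * w + ((2 * (b - a) : ℝ) : ℂ) * t w with hu
    have hun : NonnegTaylor u := (NonnegTaylor.id.const_mul ha0.le).add (hB.nonneg.const_mul hba.le)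
    have e {w : ℂ} (hw : besselEntire ν w ≠ 0) :
        besselNEntire a b c ν w = besselEntire ν w * (quadQ a b c ν - u w) := by
      have h1 := eulerOp_eulerOp_besselEntire hν w
      rw [PosLogDeriv.eulerOp_eq_of_ne hw] at h1
      rw [besselNEntire_eq, PosLogDeriv.eulerOp_eq_of_ne hw]
      simp only [hu, ht]
      push_cast
      linear_combination 4 * (a : ℂ) * h1
    refine ⟨hB.of_eq_mul hun (by simp [hu, ht]) hQ0 (besselNEntire_differentiable a b c ν) ?_, ?_⟩
    · filter_upwards [hB.diff.continuous.continuousAt.eventually_ne hB.ne] with w hw using e hw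
    -- At this `x` the summand `2(b - a) t` alone equals `Q(ν)`, so `u(x) ≥ Q(ν)`; as `u(0) = 0`,
    -- the factor `Q(ν) - u` vanishes at some point of `(0, x]`.
    · obtain ⟨x, y, hx, hxy, hne, h⟩ := hB.exists_negLogDeriv_eq (div_pos hQ0 hba)
      have hdt := negLogDeriv_differentiableOn hB.diff hne
      have hdu : DifferentiableOn ℂ u (Metric.ball 0 y) :=
        (differentiableOn_id.const_mul _).add (hdt.const_mul _)
      have hcu : ContinuousOn (fun x : ℝ => (u x).re) (Set.Icc 0 x) := by
        refine Complex.continuous_re.comp_continuousOn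
          (hdu.continuousOn.comp Complex.continuous_ofReal.continuousOn fun s hs => ?_)
        simpa [abs_of_nonneg hs.1] using hs.2.trans_lt hxy
      have hux : quadQ a b c ν ≤ (u x).re := by
        simp only [hu, ht, h]
        rw [← Complex.ofReal_mul, ← Complex.ofReal_mul, ← Complex.ofReal_add, Complex.ofReal_re,
          mul_div_cancel₀ _ hba.ne']
        nlinarith
      obtain ⟨s, hs, hse⟩ := intermediate_value_Icc hx.le hcu
        (show quadQ a b c ν ∈ _ from ⟨by simpa [hu, ht] using hQ0.le, hux⟩)
      have hs0 : s ≠ 0 := by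
        rintro rfl
        simp [hu, ht] at hse
        exact hQ hse.symm
      refine ⟨s, lt_of_le_of_ne hs.1 hs0.symm, ?_⟩
      have hsy := hs.2.trans_lt hxy
      rw [e (hne _ (by simpa [abs_of_nonneg hs.1] using hsy)), ← hun.coe_re hdu hs.1 hsy]
      simp only at hse
      rw [hse, sub_self, mul_zero]

/-! ### From the entire factor back to `N_ν` on the slit plane -/

/-- Conjugation of the Euler operator by `z ↦ z^ν`. -/
theorem eulerOp_cpow_mul_comp_sq {f F : ℂ → ℂ} (hF : Differentiable ℂ F) {C : ℂ} {ν : ℝ}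
    (h : ∀ z ∈ Complex.slitPlane, f z = C * (z ^ (ν : ℂ) * F (z ^ 2))) {z : ℂ}
    (hz : z ∈ Complex.slitPlane) :
    DifferentiableAt ℂ f z ∧ eulerOp f z = C * (z ^ (ν : ℂ) * laguerreOp ν F (z ^ 2)) := by
  have heq : f =ᶠ[𝓝 z] fun z => C * (z ^ (ν : ℂ) * F (z ^ 2)) := by
    filter_upwards [Complex.isOpen_slitPlane.mem_nhds hz] with w hw using h w hw
  have h1 : HasDerivAt (fun z : ℂ => z ^ (ν : ℂ)) (ν * z ^ ((ν : ℂ) - 1)) z :=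
    (hasDerivAt_id z).cpow_const hz |>.congr_deriv (by simp)
  have h2 : HasDerivAt (fun z : ℂ => F (z ^ 2)) (deriv F (z ^ 2) * (2 * z)) z := by
    have := (hF (z ^ 2)).hasDerivAt.comp z (hasDerivAt_pow 2 z)
    exact this.congr_deriv (by simp)
  have h3 := ((h1.mul h2).const_mul C).congr_of_eventuallyEq heq
  refine ⟨h3.differentiableAt, ?_⟩
  have hz0 : z ≠ 0 := Complex.slitPlane_ne_zero hz
  rw [eulerOp, h3.deriv, laguerreOp, eulerOp, Complex.cpow_sub _ _ hz0, Complex.cpow_one]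
  field_simp

theorem sq_mul_iteratedDeriv_two {f : ℂ → ℂ} {z : ℂ} (hf : DifferentiableAt ℂ (eulerOp f) z)
    (hz : z ≠ 0) : z ^ 2 * iteratedDeriv 2 f z = eulerOp (eulerOp f) z - eulerOp f z := by
  have h : deriv f =ᶠ[𝓝 z] fun w => w⁻¹ * eulerOp f w := by
    filter_upwards [eventually_ne_nhds hz] with w hw
    rw [eulerOp]
    field_simp
  rw [iteratedDeriv_succ, iteratedDeriv_one, h.deriv_eq,
    deriv_fun_mul (differentiableAt_inv hz) hf, deriv_inv]
  simp only [eulerOp]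
  field_simp
  ring

/-- Dividing by a positive real does not change the argument, so the principal power splits. At `z =
0` the conventions `0 ^ 0 = 1` and `0 ^ ν = 0` for `ν ≠ 0` make both sides agree. -/
theorem div_two_cpow (z : ℂ) (ν : ℝ) : (z / 2) ^ (ν : ℂ) = (2 ^ (ν : ℂ))⁻¹ * z ^ (ν : ℂ) := by
  rcases eq_or_ne z 0 with rfl | hz
  · rcases eq_or_ne ν 0 with rfl | h
    · simp
    · simp [h]
  · have : z / 2 = ((2⁻¹ : ℝ) : ℂ) * z := by push_cast; ring
    rw [Complex.cpow_def_of_ne_zero (by simpa using hz), Complex.cpow_def_of_ne_zero hz,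
      Complex.cpow_def_of_ne_zero two_ne_zero, this, Complex.log_ofReal_mul (by norm_num) hz,
      ← Complex.exp_neg, ← Complex.exp_add, Real.log_inv]
    congr 1
    have : Complex.log 2 = (Real.log 2 : ℝ) := by simp
    rw [this]
    push_cast
    ring

/-- Each application of `z d/dz` to `z^ν F(z²)` replaces `F` by `ν F + 2 E F`, and `z² d²/dz² = θ² -
θ`. -/
theorem besselN_eq {a b c ν : ℝ} {z : ℂ} (hz : z ∈ Complex.slitPlane) :
    besselN a b c ν z = (2 ^ (ν : ℂ))⁻¹ * (z ^ (ν : ℂ) * besselNEntire a b c ν (z ^ 2)) := by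
  have hB := besselEntire_differentiable ν
  have h0 : ∀ z ∈ Complex.slitPlane,
      besselJ ν z = (2 ^ (ν : ℂ))⁻¹ * (z ^ (ν : ℂ) * besselEntire ν (z ^ 2)) := fun z hz => by
    rw [besselJ_eq ν (Complex.slitPlane_ne_zero hz), div_two_cpow, mul_assoc]
  have h1 := fun z hz => (eulerOp_cpow_mul_comp_sq hB h0 (z := z) hz).2
  obtain ⟨h2, h3⟩ := eulerOp_cpow_mul_comp_sq (hB.laguerreOp ν) h1 hz
  have h4 := sq_mul_iteratedDeriv_two h2 (Complex.slitPlane_ne_zero hz)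
  have h5 := h1 z hz
  rw [besselN, mul_assoc, h4, h3, mul_assoc, ← eulerOp, h5, h0 z hz, besselNEntire]
  ring

theorem besselN_derivs {a b c ν : ℝ} {z : ℂ} (hz : z ∈ Complex.slitPlane) :
    eulerOp (besselN a b c ν) z = (2 ^ (ν : ℂ))⁻¹ *
      (z ^ (ν : ℂ) * laguerreOp ν (besselNEntire a b c ν) (z ^ 2)) ∧
    z ^ 2 * iteratedDeriv 2 (besselN a b c ν) z = (2 ^ (ν : ℂ))⁻¹ * (z ^ (ν : ℂ) *
      (laguerreOp ν (laguerreOp ν (besselNEntire a b c ν)) (z ^ 2) -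
        laguerreOp ν (besselNEntire a b c ν) (z ^ 2))) := by
  have hB := besselNEntire_differentiable a b c ν
  have h1 := fun z hz =>
    (eulerOp_cpow_mul_comp_sq hB (fun z hz => besselN_eq (a := a) (b := b) (c := c) hz) (z := z)
      hz).2
  obtain ⟨h2, h3⟩ := eulerOp_cpow_mul_comp_sq (hB.laguerreOp ν) h1 hz
  refine ⟨h1 z hz, ?_⟩
  rw [sq_mul_iteratedDeriv_two h2 (Complex.slitPlane_ne_zero hz), h3, h1 z hz]
  ring

/-! ### Criteria for the radius of convexity -/

theorem tendsto_ofReal_nhdsGT_zero : Tendsto ((↑) : ℝ → ℂ) (𝓝[>] 0) (𝓝[≠] 0) := by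
  refine tendsto_nhdsWithin_iff.2 ⟨?_, ?_⟩
  · exact (Complex.continuous_ofReal.tendsto' 0 0 (by simp)).mono_left nhdsWithin_le_nhds
  · filter_upwards [self_mem_nhdsWithin] with x hx
    simpa using (ne_of_gt hx : x ≠ 0)

/-- If the convexity functional of the analytic function `G` given by `f` exceeds `β` on the disk of
radius `ρ`, and equals `β` at the point `ρ`, then `ρ` is the radius of convexity. -/
theorem radiusOfConvexity_eq {β ρ R : ℝ} {f G : ℂ → ℂ} (hρ : 0 < ρ) (hρR : ρ < R)
    (hG : IsAnalyticOnDisk f R G) (hconv : IsConvexOfOrderOnDisk β ρ G)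
    (hval : (1 + (ρ : ℂ) * iteratedDeriv 2 G ρ / deriv G ρ).re = β) :
    radiusOfConvexity β f = ρ := by
  refine IsGreatest.csSup_eq ⟨⟨hρ, G, ⟨hG.1.mono (Metric.ball_subset_ball hρR.le), hG.2⟩, hconv⟩, ?_⟩
  rintro r ⟨_, F, hF, hFc⟩
  by_contra! hlt
  -- On a larger disk the two analytic functions agree near `ρ` by the identity theorem, so the
  -- functional equals `β` at `ρ`, against the strict inequality.
  have hm : ρ < min r R := lt_min hlt hρR
  have hfreq : ∃ᶠ z in 𝓝[≠] (0 : ℂ), F z = G z := by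
    refine tendsto_ofReal_nhdsGT_zero.frequently (Eventually.frequently ?_)
    filter_upwards [hF.2, hG.2] with x h1 h2
    rw [h1, h2]
  have heq : Set.EqOn F G (Metric.ball 0 (min r R)) :=
    AnalyticOnNhd.eqOn_of_preconnected_of_frequently_eq
      ((hF.1.mono (Metric.ball_subset_ball (min_le_left _ _))).analyticOnNhd Metric.isOpen_ball)
      ((hG.1.mono (Metric.ball_subset_ball (min_le_right _ _))).analyticOnNhd Metric.isOpen_ball)
      (convex_ball _ _).isPreconnected (Metric.mem_ball_self (hρ.trans hm)) hfreq
  have hmem : (ρ : ℂ) ∈ Metric.ball (0 : ℂ) (min r R) := by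
    simpa [abs_of_pos hρ] using hm
  have h1 := (hFc ρ (by simpa [abs_of_pos hρ] using hlt)).2
  have hnear : F =ᶠ[𝓝 (ρ : ℂ)] G := heq.eventuallyEq_of_mem (Metric.isOpen_ball.mem_nhds hmem)
  rw [hnear.iteratedDeriv_eq, hnear.deriv_eq, hval] at h1
  exact lt_irrefl _ h1

theorem mul_div_eq_neg_negLogDeriv (F : ℂ → ℂ) (w : ℂ) :
    eulerOp F w / F w = -negLogDeriv F w := by
  simp [negLogDeriv]

namespace PosLogDeriv

variable {F : ℂ → ℂ}

/-- On a circle the norm is at most the value at the positive point, which increases strictly with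
the radius. -/
theorem re_negLogDeriv_lt (hF : PosLogDeriv F) {x y τ : ℝ} (hxy : x < y)
    (hne : ∀ w, ‖w‖ < y → F w ≠ 0) (hx : negLogDeriv F x = τ) {w : ℂ} (hw : ‖w‖ < x) :
    ‖negLogDeriv F w‖ < τ := by
  have hd := negLogDeriv_differentiableOn hF.diff hne
  refine (hF.nonneg.norm_le hd (hw.trans hxy)).trans_lt ?_
  have := hF.nonneg.re_lt_re hd hF.pos (norm_nonneg w) hw hxy
  rwa [hx, Complex.ofReal_re] at this

/-- The convexity functional of `f` for `f'(z) = K F(z²)` or `f'(z) = K F(z)` is governed by the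
negative logarithmic derivative of `F`. -/
theorem exists_radius (hF : PosLogDeriv F) {β κ : ℝ} (hβ : β < 1) (hκ : 0 < κ) :
    ∃ x : ℝ, 0 < x ∧ F x ≠ 0 ∧ 1 + κ * (eulerOp F x / F x) = β ∧
      ∀ w : ℂ, ‖w‖ < x → F w ≠ 0 ∧ β < (1 + κ * (eulerOp F w / F w)).re := by
  obtain ⟨x, y, hx, hxy, hne, h⟩ := hF.exists_negLogDeriv_eq (div_pos (sub_pos.2 hβ) hκ)
  have hκ0 : (κ : ℂ) ≠ 0 := by exact_mod_cast hκ.ne'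
  refine ⟨x, hx, hne _ (by simpa [abs_of_pos hx] using hxy), ?_, fun w hw => ⟨hne w
    (hw.trans hxy), ?_⟩⟩
  · rw [mul_div_eq_neg_negLogDeriv, h]
    push_cast
    field_simp
    ring
  · rw [mul_div_eq_neg_negLogDeriv]
    have h1 := (Complex.re_le_norm _).trans_lt (hF.re_negLogDeriv_lt hxy hne h hw)
    rw [lt_div_iff₀ hκ] at h1
    simp
    linarith

/-- For `p = 1 + (2/ν) w F'/F`, the functional `p + 2 w p'/p` decreases from `1` to `-∞` between the
origin and the first zero of `p`, and is minimal on circles at the positive point. -/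
theorem exists_radius_rpow (hF : PosLogDeriv F) {β ν : ℝ} (hβ : β < 1) (hν : 0 < ν) :
    ∃ ρ x y : ℝ, 0 < ρ ∧ ρ < x ∧ x < y ∧ (∀ w, ‖w‖ < y → F w ≠ 0) ∧
      negLogDeriv F x = (ν / 2 : ℝ) ∧
      (∀ w, ‖w‖ < x → 1 - 2 / ν * negLogDeriv F w ≠ 0) ∧
      1 - 2 / ν * negLogDeriv F ρ -
        4 / ν * eulerOp (negLogDeriv F) ρ / (1 - 2 / ν * negLogDeriv F ρ) = β ∧
      ∀ w : ℂ, ‖w‖ < ρ → β < (1 - 2 / ν * negLogDeriv F w -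
        4 / ν * eulerOp (negLogDeriv F) w / (1 - 2 / ν * negLogDeriv F w)).re := by
  obtain ⟨x, y, hx, hxy, hne, h⟩ := hF.exists_negLogDeriv_eq (half_pos hν)
  set t := negLogDeriv F with ht
  have hd : DifferentiableOn ℂ t (Metric.ball 0 y) := negLogDeriv_differentiableOn hF.diff hne
  have hdE : DifferentiableOn ℂ (eulerOp t) (Metric.ball 0 y) :=
    differentiableOn_id.mul (hd.deriv Metric.isOpen_ball)
  have hν0 : (ν : ℂ) ≠ 0 := by exact_mod_cast hν.ne'
  have hlt (w : ℂ) (hw : ‖w‖ < x) : ‖t w‖ < ν / 2 := hF.re_negLogDeriv_lt hxy hne h hw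
  have hp (w : ℂ) (hw : ‖w‖ < x) : 1 - 2 / ν * t w ≠ 0 := by
    intro h0
    have : t w = ((ν / 2 : ℝ) : ℂ) := by
      push_cast
      field_simp at h0
      linear_combination -h0 / 2
    have h1 := hlt w hw
    rw [this, Complex.norm_real, Real.norm_of_nonneg (half_pos hν).le] at h1
    exact lt_irrefl _ h1
  -- The functional is `1 - U`, and `U` has nonnegative coefficients because `1 / (1 - (2/ν) t)`
  -- does.
  set U : ℂ → ℂ := fun w => ((2 / ν : ℝ) : ℂ) * t w +
    ((4 / ν : ℝ) : ℂ) * (eulerOp t w * (((1 : ℝ) : ℂ) - ((2 / ν : ℝ) : ℂ) * t w)⁻¹) with hU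
  have hpt : NonnegTaylor fun w => ((2 / ν : ℝ) : ℂ) * t w := hF.nonneg.const_mul (by positivity)
  have hV := (hF.nonneg.eulerOp.mul (hpt.inv_const_sub (by simp [ht]) one_pos)).const_mul
    (x := 4 / ν) (by positivity)
  have hUn : NonnegTaylor U := hpt.add hV
  have hU1 : 0 < (deriv U 0).re := by
    rw [hU, deriv_fun_add hpt.1.differentiableAt hV.1.differentiableAt, deriv_const_mul_field,
      Complex.add_re, Complex.re_ofReal_mul]
    have h1 := hV.re_iteratedDeriv_nonneg 1
    rw [iteratedDeriv_one] at h1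
    have h2 := hF.pos
    have : 0 < 2 / ν * (deriv t 0).re := by positivity
    linarith
  have hUeq (w : ℂ) : 1 - 2 / ν * t w - 4 / ν * eulerOp t w / (1 - 2 / ν * t w) = 1 - U w := by
    simp only [hU]
    push_cast
    ring
  have hsub : Metric.ball (0 : ℂ) x ⊆ Metric.ball 0 y := Metric.ball_subset_ball hxy.le
  have hUd : DifferentiableOn ℂ U (Metric.ball 0 x) := by
    refine ((hd.mono hsub).const_mul _).add (((hdE.mono hsub).mul (DifferentiableOn.inv
      ((differentiableOn_const _).sub ((hd.mono hsub).const_mul _)) fun w hw => ?_)).const_mul _)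
    simpa using hp w (by simpa using hw)
  obtain ⟨ρ, hρ0, hρx, hρ⟩ : ∃ ρ : ℝ, 0 < ρ ∧ ρ < x ∧ U ρ = ((1 - β : ℝ) : ℂ) := by
    -- With `p = 1 - (2/ν) t`, `k` is `p` times (functional minus `β`). This removes the pole at
    -- `x`, where `p = 0` and `k = -(4/ν) E t < 0`, while `k(0) = 1 - β > 0`.
    set k : ℝ → ℝ := fun s => (1 - 2 / ν * (t s).re) ^ 2 - 4 / ν * (eulerOp t s).re -
      β * (1 - 2 / ν * (t s).re) with hk
    have hmaps : Set.MapsTo ((↑) : ℝ → ℂ) (Set.Icc 0 x) (Metric.ball 0 y) := fun s hs => by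
      simpa [abs_of_nonneg hs.1] using hs.2.trans_lt hxy
    have hc1 : ContinuousOn (fun s : ℝ => (t s).re) (Set.Icc 0 x) :=
      Complex.continuous_re.comp_continuousOn
        (hd.continuousOn.comp Complex.continuous_ofReal.continuousOn hmaps)
    have hc2 : ContinuousOn (fun s : ℝ => (eulerOp t s).re) (Set.Icc 0 x) :=
      Complex.continuous_re.comp_continuousOn
        (hdE.continuousOn.comp Complex.continuous_ofReal.continuousOn hmaps)
    have hck : ContinuousOn k (Set.Icc 0 x) := by fun_prop
    have hEx : 0 < (eulerOp t x).re := by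
      have hd1 : (deriv (eulerOp t) 0).re = (deriv t 0).re := by
        have := iteratedDeriv_eulerOp_zero hF.nonneg.1 1
        rw [iteratedDeriv_one, iteratedDeriv_one] at this
        rw [this]
        simp [ht]
      have := hF.nonneg.eulerOp.linear_le hdE hx.le hxy
      rw [hd1] at this
      exact (mul_pos hF.pos hx).trans_le this
    have hkx : k x < 0 := by
      have e : 2 / ν * (ν / 2) = 1 := by field_simp
      simp only [hk, h, Complex.ofReal_re, e]
      have : 0 < 4 / ν * (eulerOp t x).re := by positivity
      linarith
    have hk0 : 0 < k 0 := by simpa [hk, ht] using hβ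
    obtain ⟨s, hs, hs0⟩ := intermediate_value_Icc' hx.le hck (show (0 : ℝ) ∈ _ from ⟨hkx.le, hk0.le⟩)
    have hs1 : s ≠ 0 := by rintro rfl; exact hk0.ne' hs0
    have hs2 : s ≠ x := by rintro rfl; exact hkx.ne hs0
    have hsx : s < x := lt_of_le_of_ne hs.2 hs2
    refine ⟨s, lt_of_le_of_ne hs.1 hs1.symm, hsx, ?_⟩
    have hps := hp s (by simpa [abs_of_nonneg hs.1] using hsx)
    have e1 := hF.nonneg.coe_re hd hs.1 (hsx.trans hxy)
    have e2 := hF.nonneg.eulerOp.coe_re hdE hs.1 (hsx.trans hxy)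
    have hsC : (1 - 2 / ν * t s) ^ 2 - 4 / ν * eulerOp t s - β * (1 - 2 / ν * t s) = 0 := by
      rw [← ht] at e1
      rw [← e1, ← e2]
      exact_mod_cast hs0
    have : 1 - U s = β := by
      rw [← hUeq, sub_eq_iff_eq_add, ← sub_eq_iff_eq_add', eq_div_iff hps]
      linear_combination hsC
    push_cast
    linear_combination -this
  refine ⟨ρ, x, y, hρ0, hρx, hxy, hne, h, hp, ?_, fun w hw => ?_⟩
  · rw [hUeq, hρ]
    push_cast
    ring
  · rw [hUeq]
    have h1 := hUn.re_lt_re hUd hU1 (norm_nonneg w) hw hρx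
    have h2 := (Complex.re_le_norm _).trans (hUn.norm_le hUd (hw.trans hρx))
    rw [hρ, Complex.ofReal_re] at h1
    simp only [Complex.sub_re, Complex.one_re]
    linarith

end PosLogDeriv

/-! ### Values of `N_ν` and its derivatives on the positive axis -/

section ofReal

variable {a b c ν : ℝ}

theorem ofReal_mem_slitPlane {r : ℝ} (hr : 0 < r) : (r : ℂ) ∈ Complex.slitPlane :=
  Complex.ofReal_mem_slitPlane.2 hr

theorem two_cpow_inv_mul_cpow_ne_zero {r : ℝ} (hr : 0 < r) :
    ((2 : ℂ) ^ (ν : ℂ))⁻¹ * (r : ℂ) ^ (ν : ℂ) ≠ 0 := by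
  have : (r : ℂ) ≠ 0 := by exact_mod_cast hr.ne'
  simp [Complex.cpow_eq_zero_iff, this]

theorem besselN_ofReal {r : ℝ} (hr : 0 < r) : besselN a b c ν r =
    ((2 : ℂ) ^ (ν : ℂ))⁻¹ * (r : ℂ) ^ (ν : ℂ) * besselNEntire a b c ν (r ^ 2) := by
  rw [besselN_eq (ofReal_mem_slitPlane hr), mul_assoc]

theorem mul_deriv_besselN_ofReal {r : ℝ} (hr : 0 < r) : r * deriv (besselN a b c ν) r =
    ((2 : ℂ) ^ (ν : ℂ))⁻¹ * (r : ℂ) ^ (ν : ℂ) * laguerreOp ν (besselNEntire a b c ν) (r ^ 2) := by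
  rw [mul_assoc, ← (besselN_derivs (ofReal_mem_slitPlane hr)).1, eulerOp]

theorem sq_mul_deriv_besselN_ofReal {r : ℝ} (hr : 0 < r) :
    (r : ℂ) ^ 2 * iteratedDeriv 2 (besselN a b c ν) r =
    ((2 : ℂ) ^ (ν : ℂ))⁻¹ * (r : ℂ) ^ (ν : ℂ) *
      (laguerreOp ν (laguerreOp ν (besselNEntire a b c ν)) (r ^ 2) -
        laguerreOp ν (besselNEntire a b c ν) (r ^ 2)) := by
  rw [mul_assoc, ← (besselN_derivs (ofReal_mem_slitPlane hr)).2]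

theorem deriv_besselN_ofReal_eq_zero_iff {r : ℝ} (hr : 0 < r) :
    deriv (besselN a b c ν) r = 0 ↔ laguerreOp ν (besselNEntire a b c ν) (r ^ 2) = 0 := by
  have h := mul_deriv_besselN_ofReal (a := a) (b := b) (c := c) (ν := ν) hr
  have h1 := two_cpow_inv_mul_cpow_ne_zero (ν := ν) hr
  have h2 : (r : ℂ) ≠ 0 := by exact_mod_cast hr.ne'
  constructor
  · intro h0
    rw [h0, mul_zero] at h
    exact (mul_eq_zero.1 h.symm).resolve_left h1
  · intro h0
    rw [h0, mul_zero] at h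
    exact (mul_eq_zero.1 h).resolve_left h2

theorem besselN_ofReal_eq_zero_iff {r : ℝ} (hr : 0 < r) :
    besselN a b c ν r = 0 ↔ besselNEntire a b c ν (r ^ 2) = 0 := by
  rw [besselN_ofReal hr, mul_eq_zero, or_iff_right (two_cpow_inv_mul_cpow_ne_zero hr)]

/-- The constant `Γ(ν+1) / Q(ν)`. -/
theorem normConst_mul (a b c ν : ℝ) : normConst a b c ν * ((2 : ℂ) ^ (ν : ℂ))⁻¹ =
    Complex.Gamma ((ν : ℂ) + 1) / quadQ a b c ν := by
  have : (2 : ℂ) ^ (ν : ℂ) ≠ 0 := by simp [Complex.cpow_eq_zero_iff]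
  rw [normConst]
  field_simp

end ofReal

/-! ### The radii of `g_ν` and `h_ν` -/

theorem hasDerivAt_comp_sq {F : ℂ → ℂ} {z : ℂ} (hF : DifferentiableAt ℂ F (z ^ 2)) :
    HasDerivAt (fun z => F (z ^ 2)) (deriv F (z ^ 2) * (2 * z)) z := by
  have := hF.hasDerivAt.comp z (hasDerivAt_pow 2 z)
  exact this.congr_deriv (by simp)

/-- The factor 2 comes from `z d/dz = 2E` on functions of `w = z²`; it is the `κ` used for `g_ν`,
whereas `κ = 1` for `h_ν`. -/
theorem mul_iteratedDeriv_two_div_of_deriv_eq_comp_sq {G F : ℂ → ℂ} {K z : ℂ} (hK : K ≠ 0)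
    (hF : Differentiable ℂ F) (hG : ∀ z, deriv G z = K * F (z ^ 2)) :
    z * iteratedDeriv 2 G z / deriv G z = 2 * (eulerOp F (z ^ 2) / F (z ^ 2)) := by
  have h := (hasDerivAt_comp_sq (hF (z ^ 2))).const_mul K
  rw [iteratedDeriv_succ, iteratedDeriv_one, funext hG, h.deriv, eulerOp, ← mul_div_assoc,
    ← mul_div_mul_left _ (F (z ^ 2)) hK]
  ring

theorem mul_iteratedDeriv_two_div_of_deriv_eq {G F : ℂ → ℂ} {K z : ℂ} (hK : K ≠ 0)
    (hG : ∀ z, deriv G z = K * F z) :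
    z * iteratedDeriv 2 G z / deriv G z = eulerOp F z / F z := by
  rw [iteratedDeriv_succ, iteratedDeriv_one, funext hG, deriv_const_mul_field, eulerOp,
    ← mul_div_mul_left _ (F z) hK]
  ring

section radii

variable {a b c β ν : ℝ}

theorem normConst_mul_ne_zero (hν : 0 ≤ ν) (hQ : quadQ a b c ν ≠ 0) :
    normConst a b c ν * ((2 : ℂ) ^ (ν : ℂ))⁻¹ ≠ 0 := by
  rw [normConst_mul]
  exact div_ne_zero (Gamma_ofReal_add_one_ne_zero hν) (by exact_mod_cast hQ)

theorem normG_analytic {R : ℝ} : IsAnalyticOnDisk (normG a b c ν) R fun z =>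
    normConst a b c ν * ((2 : ℂ) ^ (ν : ℂ))⁻¹ * (z * besselNEntire a b c ν (z ^ 2)) := by
  have hd := besselNEntire_differentiable a b c ν
  refine ⟨Differentiable.differentiableOn (by fun_prop), ?_⟩
  filter_upwards [self_mem_nhdsWithin] with x hx
  have hx0 : (x : ℂ) ≠ 0 := by exact_mod_cast (ne_of_gt hx : x ≠ 0)
  rw [normG, besselN_ofReal hx, Complex.cpow_sub _ _ hx0, Complex.cpow_one]
  have : (x : ℂ) ^ (ν : ℂ) ≠ 0 := by simp [Complex.cpow_eq_zero_iff, hx0]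
  field_simp

theorem normH_analytic {R : ℝ} : IsAnalyticOnDisk (normH a b c ν) R fun z =>
    normConst a b c ν * ((2 : ℂ) ^ (ν : ℂ))⁻¹ * (z * besselNEntire a b c ν z) := by
  have hd := besselNEntire_differentiable a b c ν
  refine ⟨Differentiable.differentiableOn (by fun_prop), ?_⟩
  filter_upwards [self_mem_nhdsWithin] with x hx
  have hx' : 0 < x := hx
  have hx0 : (x : ℂ) ≠ 0 := by exact_mod_cast hx'.ne'
  have h1 : (x : ℂ) ^ (1 / 2 : ℂ) = (√x : ℝ) := by
    rw [Real.sqrt_eq_rpow, Complex.ofReal_cpow hx'.le]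
    norm_num
  have h2 : ((√x : ℝ) : ℂ) ^ 2 = x := by
    rw [← Complex.ofReal_pow, Real.sq_sqrt hx'.le]
  have h3 : ((√x : ℝ) : ℂ) ^ (ν : ℂ) = (x : ℂ) ^ ((ν : ℂ) / 2) := by
    rw [← Complex.ofReal_cpow (Real.sqrt_nonneg x), Real.sqrt_eq_rpow, ← Real.rpow_mul hx'.le,
      Complex.ofReal_cpow hx'.le]
    congr 1
    push_cast
    ring
  rw [normH, h1, besselN_ofReal (Real.sqrt_pos.2 hx'), h2, h3, Complex.cpow_sub _ _ hx0,
    Complex.cpow_one]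
  have : (x : ℂ) ^ ((ν : ℂ) / 2) ≠ 0 := by simp [Complex.cpow_eq_zero_iff, hx0]
  field_simp

theorem norm_sq_lt_of_mem_ball_sqrt {z : ℂ} {x : ℝ} (hx : 0 ≤ x) (hz : z ∈ Metric.ball 0 (√x)) :
    ‖z ^ 2‖ < x := by
  rw [mem_ball_zero_iff] at hz
  rw [norm_pow, ← Real.sq_sqrt hx]
  gcongr

/-- Up to a constant, `g_ν = z Φ(z²)`, whose derivative is `F(z²)` with `F = Φ + 2 E Φ`. On the
positive axis the denominator and numerator of the equation are the same nonzero factor times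
`F(r²)` and `2 E F(r²)`. -/
theorem radiusOfConvexity_normG_isLeast (hP : PosLogDeriv (besselNEntire a b c ν)) (hβ : β < 1)
    (hν : 0 ≤ ν) (hQ : quadQ a b c ν ≠ 0) :
    IsLeast {r : ℝ | 0 < r ∧
        (r : ℂ) * deriv (besselN a b c ν) (r : ℂ)
          + (1 - (ν : ℂ)) * besselN a b c ν (r : ℂ) ≠ 0 ∧
        1 + ((r : ℂ) ^ 2 * iteratedDeriv 2 (besselN a b c ν) (r : ℂ)
              + (2 - 2 * (ν : ℂ)) * (r : ℂ) * deriv (besselN a b c ν) (r : ℂ)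
              + ((ν : ℂ) ^ 2 - (ν : ℂ)) * besselN a b c ν (r : ℂ))
            / ((r : ℂ) * deriv (besselN a b c ν) (r : ℂ)
              + (1 - (ν : ℂ)) * besselN a b c ν (r : ℂ))
          = (β : ℂ)}
      (radiusOfConvexity β (normG a b c ν)) := by
  set F := laguerreOp 1 (besselNEntire a b c ν) with hF
  have hPF : PosLogDeriv F := hP.laguerreOp one_pos
  obtain ⟨x, hx, hx1, hx2, hx3⟩ := hPF.exists_radius hβ two_pos
  push_cast at hx2 hx3
  have hden {r : ℝ} (hr : 0 < r) : (r : ℂ) * deriv (besselN a b c ν) (r : ℂ)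
      + (1 - (ν : ℂ)) * besselN a b c ν (r : ℂ) =
      ((2 : ℂ) ^ (ν : ℂ))⁻¹ * (r : ℂ) ^ (ν : ℂ) * F (r ^ 2) := by
    rw [mul_deriv_besselN_ofReal hr, besselN_ofReal hr, hF, laguerreOp, laguerreOp]
    push_cast
    ring
  have hnum {r : ℝ} (hr : 0 < r) : (r : ℂ) ^ 2 * iteratedDeriv 2 (besselN a b c ν) (r : ℂ)
      + (2 - 2 * (ν : ℂ)) * (r : ℂ) * deriv (besselN a b c ν) (r : ℂ)
      + ((ν : ℂ) ^ 2 - (ν : ℂ)) * besselN a b c ν (r : ℂ) =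
      ((2 : ℂ) ^ (ν : ℂ))⁻¹ * (r : ℂ) ^ (ν : ℂ) * (2 * eulerOp F (r ^ 2)) := by
    rw [mul_assoc _ (r : ℂ), sq_mul_deriv_besselN_ofReal hr, mul_deriv_besselN_ofReal hr,
      besselN_ofReal hr, hF, laguerreOp_laguerreOp hP.diff, laguerreOp, eulerOp_laguerreOp hP.diff]
    push_cast
    ring
  have hK := normConst_mul_ne_zero hν hQ
  set K := normConst a b c ν * ((2 : ℂ) ^ (ν : ℂ))⁻¹
  set G : ℂ → ℂ := fun z => K * (z * besselNEntire a b c ν (z ^ 2)) with hG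
  have hG' (z : ℂ) : deriv G z = K * F (z ^ 2) := by
    have h2 := hasDerivAt_comp_sq (hP.diff (z ^ 2))
    rw [hG, (((hasDerivAt_id' z).fun_mul h2).const_mul K).deriv, hF, laguerreOp, eulerOp]
    push_cast
    ring
  have hsq : ((√x : ℝ) : ℂ) ^ 2 = x := by rw [← Complex.ofReal_pow, Real.sq_sqrt hx.le]
  have hrad : radiusOfConvexity β (normG a b c ν) = √x := by
    refine radiusOfConvexity_eq (Real.sqrt_pos.2 hx) (lt_add_one _) (G := G) normG_analytic ?_ ?_
    · intro z hz
      have h := hx3 (z ^ 2) (norm_sq_lt_of_mem_ball_sqrt hx.le hz)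
      rw [mul_iteratedDeriv_two_div_of_deriv_eq_comp_sq hK hPF.diff hG', hG']
      exact ⟨mul_ne_zero hK h.1, h.2⟩
    · rw [mul_iteratedDeriv_two_div_of_deriv_eq_comp_sq hK hPF.diff hG', hsq, hx2,
        Complex.ofReal_re]
  rw [hrad]
  refine ⟨⟨Real.sqrt_pos.2 hx, ?_, ?_⟩, ?_⟩
  · rw [hden (Real.sqrt_pos.2 hx), hsq]
    exact mul_ne_zero (two_cpow_inv_mul_cpow_ne_zero (Real.sqrt_pos.2 hx)) hx1
  · rw [hden (Real.sqrt_pos.2 hx), hnum (Real.sqrt_pos.2 hx), hsq,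
      mul_div_mul_left _ _ (two_cpow_inv_mul_cpow_ne_zero (Real.sqrt_pos.2 hx)), mul_div_assoc, hx2]
  · rintro r ⟨hr, _, h2⟩
    by_contra! hlt
    rw [hden hr, hnum hr, mul_div_mul_left _ _ (two_cpow_inv_mul_cpow_ne_zero hr),
      mul_div_assoc] at h2
    have h := (hx3 (r ^ 2) (norm_sq_lt_of_mem_ball_sqrt hx.le
      (by simpa [abs_of_pos hr] using hlt))).2
    rw [h2, Complex.ofReal_re] at h
    exact lt_irrefl _ h

/-- Up to a constant, `h_ν = z Φ(z)`, whose derivative is half of `F = 2Φ + 2 E Φ`. The denominator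
and numerator of the equation are a common nonzero factor times `F(r)` and `E F(r)`. -/
theorem radiusOfConvexity_normH_isLeast (hP : PosLogDeriv (besselNEntire a b c ν)) (hβ : β < 1)
    (hν : 0 ≤ ν) (hQ : quadQ a b c ν ≠ 0) :
    IsLeast {r : ℝ | 0 < r ∧
        2 * (√r : ℂ) * deriv (besselN a b c ν) (√r : ℂ)
          + 2 * (2 - (ν : ℂ)) * besselN a b c ν (√r : ℂ) ≠ 0 ∧
        1 + ((r : ℂ) * iteratedDeriv 2 (besselN a b c ν) (√r : ℂ)
              + (3 - 2 * (ν : ℂ)) * (√r : ℂ) * deriv (besselN a b c ν) (√r : ℂ)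
              + ((ν : ℂ) ^ 2 - 2 * (ν : ℂ)) * besselN a b c ν (√r : ℂ))
            / (2 * (√r : ℂ) * deriv (besselN a b c ν) (√r : ℂ)
              + 2 * (2 - (ν : ℂ)) * besselN a b c ν (√r : ℂ))
          = (β : ℂ)}
      (radiusOfConvexity β (normH a b c ν)) := by
  set F := laguerreOp 2 (besselNEntire a b c ν) with hF
  have hPF : PosLogDeriv F := hP.laguerreOp two_pos
  obtain ⟨x, hx, hx1, hx2, hx3⟩ := hPF.exists_radius hβ one_pos
  push_cast at hx2 hx3
  rw [one_mul] at hx2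
  simp only [one_mul] at hx3
  have hsq {r : ℝ} (hr : 0 < r) : ((√r : ℝ) : ℂ) ^ 2 = r := by
    rw [← Complex.ofReal_pow, Real.sq_sqrt hr.le]
  have hne {r : ℝ} (hr : 0 < r) :
      ((2 : ℂ) ^ (ν : ℂ))⁻¹ * ((√r : ℝ) : ℂ) ^ (ν : ℂ) * 2 ≠ 0 :=
    mul_ne_zero (two_cpow_inv_mul_cpow_ne_zero (Real.sqrt_pos.2 hr)) two_ne_zero
  have hden {r : ℝ} (hr : 0 < r) : 2 * (√r : ℂ) * deriv (besselN a b c ν) (√r : ℂ)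
      + 2 * (2 - (ν : ℂ)) * besselN a b c ν (√r : ℂ) =
      ((2 : ℂ) ^ (ν : ℂ))⁻¹ * ((√r : ℝ) : ℂ) ^ (ν : ℂ) * 2 * F r := by
    rw [mul_assoc 2, mul_deriv_besselN_ofReal (Real.sqrt_pos.2 hr),
      besselN_ofReal (Real.sqrt_pos.2 hr), hF, hsq hr, laguerreOp, laguerreOp]
    push_cast
    ring
  have hnum {r : ℝ} (hr : 0 < r) : (r : ℂ) * iteratedDeriv 2 (besselN a b c ν) (√r : ℂ)
      + (3 - 2 * (ν : ℂ)) * (√r : ℂ) * deriv (besselN a b c ν) (√r : ℂ)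
      + ((ν : ℂ) ^ 2 - 2 * (ν : ℂ)) * besselN a b c ν (√r : ℂ) =
      ((2 : ℂ) ^ (ν : ℂ))⁻¹ * ((√r : ℝ) : ℂ) ^ (ν : ℂ) * 2 * eulerOp F r := by
    have h := sq_mul_deriv_besselN_ofReal (a := a) (b := b) (c := c) (ν := ν) (Real.sqrt_pos.2 hr)
    rw [hsq hr] at h
    rw [mul_assoc _ (√r : ℂ), h, mul_deriv_besselN_ofReal (Real.sqrt_pos.2 hr),
      besselN_ofReal (Real.sqrt_pos.2 hr), hF, hsq hr, laguerreOp_laguerreOp hP.diff, laguerreOp,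
      eulerOp_laguerreOp hP.diff]
    push_cast
    ring
  have hK : normConst a b c ν * ((2 : ℂ) ^ (ν : ℂ))⁻¹ / 2 ≠ 0 :=
    div_ne_zero (normConst_mul_ne_zero hν hQ) two_ne_zero
  set K := normConst a b c ν * ((2 : ℂ) ^ (ν : ℂ))⁻¹
  set G : ℂ → ℂ := fun z => K * (z * besselNEntire a b c ν z) with hG
  have hG' (z : ℂ) : deriv G z = K / 2 * F z := by
    rw [hG, (((hasDerivAt_id' z).fun_mul (hP.diff z).hasDerivAt).const_mul K).deriv, hF, laguerreOp,
      eulerOp]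
    push_cast
    ring
  have hrad : radiusOfConvexity β (normH a b c ν) = x := by
    refine radiusOfConvexity_eq hx (lt_add_one _) (G := G) normH_analytic ?_ ?_
    · intro z hz
      have h := hx3 z (by simpa using hz)
      rw [mul_iteratedDeriv_two_div_of_deriv_eq hK hG', hG']
      exact ⟨mul_ne_zero hK h.1, h.2⟩
    · rw [mul_iteratedDeriv_two_div_of_deriv_eq hK hG', hx2, Complex.ofReal_re]
  rw [hrad]
  refine ⟨⟨hx, ?_, ?_⟩, ?_⟩
  · rw [hden hx]
    exact mul_ne_zero (hne hx) hx1
  · rw [hden hx, hnum hx, mul_div_mul_left _ _ (hne hx), hx2]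
  · rintro r ⟨hr, _, h2⟩
    by_contra! hlt
    rw [hden hr, hnum hr, mul_div_mul_left _ _ (hne hr)] at h2
    have h := (hx3 r (by simpa [abs_of_pos hr] using hlt)).2
    rw [h2, Complex.ofReal_re] at h
    exact lt_irrefl _ h

end radii

/-! ### The radius of `f_ν` -/

/-- A holomorphic logarithm on a disk centred at the origin. -/
theorem exists_log_on_ball {F : ℂ → ℂ} (hF : Differentiable ℂ F) (h0 : F 0 = 1) {y : ℝ}
    (hne : ∀ w, ‖w‖ < y → F w ≠ 0) : ∃ l : ℂ → ℂ, l 0 = 0 ∧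
      ∀ w, ‖w‖ < y → HasDerivAt l (deriv F w / F w) w ∧ Complex.exp (l w) = F w := by
  have hdF : Differentiable ℂ (deriv F) := hF.contDiff.differentiable_deriv_two
  have hd : DifferentiableOn ℂ (fun w => deriv F w / F w) (Metric.ball 0 y) :=
    hdF.differentiableOn.div hF.differentiableOn fun w hw => hne w (by simpa using hw)
  obtain ⟨l, hl0, hl⟩ := hd.isExactOn_ball.with_val_at 0 0
  refine ⟨l, hl0, fun w hw => ⟨hl w (by simpa using hw), ?_⟩⟩
  have hy : 0 < y := (norm_nonneg w).trans_lt hw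
  -- `F e^{-l}` has derivative 0 and equals 1 at the origin.
  set q : ℂ → ℂ := fun w => F w * Complex.exp (-l w) with hq
  have hq' : ∀ w ∈ Metric.ball (0 : ℂ) y, HasDerivAt q 0 w := by
    intro w hw
    refine ((hF w).hasDerivAt.mul (hl w hw).neg.cexp).congr_deriv ?_
    have := hne w (by simpa using hw)
    field_simp
    ring
  have hconst : q w = q 0 := by
    refine Metric.isOpen_ball.is_const_of_deriv_eq_zero (convex_ball _ _).isPreconnected
      (fun z hz => (hq' z hz).differentiableAt.differentiableWithinAt)
      (fun z hz => (hq' z hz).deriv) (by simpa using hw) (Metric.mem_ball_self hy)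
  simp only [hq, h0, hl0, Complex.exp_zero, Complex.exp_neg] at hconst
  field_simp at hconst
  exact hconst.symm

section

variable {a b c β ν : ℝ}

/-- For small `s > 0` the normalized `N_ν(s)` is `exp(ν log s + l(s²))`. The imaginary part of the
exponent tends to 0, so the principal logarithm returns the exponent and the principal `1/ν` power
is `s exp(l(s²)/ν)`. -/
theorem normF_analytic {F l : ℂ → ℂ} {x : ℝ} (hx : 0 < x) (hν : 0 < ν)
    (hF : ∀ w, normConst a b c ν * ((2 : ℂ) ^ (ν : ℂ))⁻¹ * besselNEntire a b c ν w = F w)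
    (hl0 : l 0 = 0) (hl : ∀ w, ‖w‖ < x → DifferentiableAt ℂ l w ∧ Complex.exp (l w) = F w) :
    IsAnalyticOnDisk (normF a b c ν) (√x) fun z => z * Complex.exp (l (z ^ 2) / ν) := by
  constructor
  · intro z hz
    have h1 := (hl (z ^ 2) (norm_sq_lt_of_mem_ball_sqrt hx.le hz)).1
    have h2 := (hasDerivAt_comp_sq h1).differentiableAt
    exact (differentiableAt_id.mul (h2.div_const _).cexp).differentiableWithinAt
  · have hcont : Tendsto (fun s : ℝ => (l ((s : ℂ) ^ 2)).im) (𝓝[>] 0) (𝓝 0) := by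
      have h1 : ContinuousAt l 0 := (hl 0 (by simpa using hx)).1.continuousAt
      have h2 : Tendsto (fun s : ℝ => (s : ℂ) ^ 2) (𝓝 0) (𝓝 0) := by
        have : Continuous fun s : ℝ => (s : ℂ) ^ 2 := by fun_prop
        simpa using this.tendsto 0
      have h3 := (Complex.continuous_im.tendsto _).comp (h1.tendsto.comp h2)
      rw [hl0, Complex.zero_im] at h3
      exact h3.mono_left nhdsWithin_le_nhds
    have hν0 : (ν : ℂ) ≠ 0 := by exact_mod_cast hν.ne'
    have hsmall : ∀ᶠ s : ℝ in 𝓝[>] 0, s < √x :=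
      nhdsWithin_le_nhds (eventually_lt_nhds (Real.sqrt_pos.2 hx))
    filter_upwards [self_mem_nhdsWithin, hsmall,
      hcont.eventually (Ioo_mem_nhds (neg_lt_zero.2 Real.pi_pos) Real.pi_pos)] with s hs hsx him
    have hs' : 0 < s := hs
    have hs0 : (s : ℂ) ≠ 0 := by exact_mod_cast hs'.ne'
    have hball : ‖(s : ℂ) ^ 2‖ < x :=
      norm_sq_lt_of_mem_ball_sqrt hx.le (by simpa [abs_of_pos hs'] using hsx)
    have e : normConst a b c ν * besselN a b c ν s =
        Complex.exp (ν * Real.log s + l ((s : ℂ) ^ 2)) := by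
      rw [besselN_ofReal hs', Complex.exp_add, (hl _ hball).2, ← hF, Complex.cpow_def_of_ne_zero hs0,
        ← Complex.ofReal_log hs'.le, mul_comm (ν : ℂ)]
      ring
    have elog : Complex.log (Complex.exp (ν * Real.log s + l ((s : ℂ) ^ 2))) =
        ν * Real.log s + l ((s : ℂ) ^ 2) := by
      have : (ν * Real.log s + l ((s : ℂ) ^ 2) : ℂ).im = (l ((s : ℂ) ^ 2)).im := by simp
      exact Complex.log_exp (by rw [this]; exact him.1) (by rw [this]; exact him.2.le)
    rw [normF, e, Complex.cpow_def_of_ne_zero (Complex.exp_ne_zero _), elog, add_mul,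
      Complex.exp_add]
    have e1 : (ν : ℂ) * Real.log s * (1 / ν) = Complex.log s := by
      rw [Complex.ofReal_log hs'.le]
      field_simp
    rw [e1, Complex.exp_log hs0, mul_one_div]

/-- The convexity functional of `z exp(l(z²)/ν)` where `l` is a logarithm of `F`. -/
theorem convexity_functional_exp {F l : ℂ → ℂ} {x : ℝ} (hx : 0 < x)
    (hF : Differentiable ℂ F) (hν : 0 < ν)
    (hne : ∀ w, ‖w‖ < x → F w ≠ 0)
    (hl : ∀ w, ‖w‖ < x → HasDerivAt l (deriv F w / F w) w)
    (hp : ∀ w, ‖w‖ < x → 1 - 2 / ν * negLogDeriv F w ≠ 0)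
    {z : ℂ} (hz : z ∈ Metric.ball 0 (√x)) :
    deriv (fun z => z * Complex.exp (l (z ^ 2) / ν)) z ≠ 0 ∧
    1 + z * iteratedDeriv 2 (fun z => z * Complex.exp (l (z ^ 2) / ν)) z /
        deriv (fun z => z * Complex.exp (l (z ^ 2) / ν)) z =
      1 - 2 / ν * negLogDeriv F (z ^ 2) - 4 / ν * eulerOp (negLogDeriv F) (z ^ 2) /
        (1 - 2 / ν * negLogDeriv F (z ^ 2)) := by
  set E : ℂ → ℂ := fun z => Complex.exp (l (z ^ 2) / ν) with hE
  set t := negLogDeriv F with ht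
  have hν0 : (ν : ℂ) ≠ 0 := by exact_mod_cast hν.ne'
  have hE' {z : ℂ} (hz : z ∈ Metric.ball 0 (√x)) :
      HasDerivAt E (E z * (deriv F (z ^ 2) / F (z ^ 2) * (2 * z) / ν)) z := by
    have h1 := hl _ (norm_sq_lt_of_mem_ball_sqrt hx.le hz)
    have h2 := hasDerivAt_comp_sq h1.differentiableAt
    rw [h1.deriv] at h2
    exact (h2.div_const (ν : ℂ)).cexp
  have hzE {z : ℂ} (hz : z ∈ Metric.ball 0 (√x)) :
      z * (deriv F (z ^ 2) / F (z ^ 2) * (2 * z) / ν) = -(2 / ν * t (z ^ 2)) := by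
    simp only [ht, negLogDeriv, eulerOp]
    ring
  have hG' {z : ℂ} (hz : z ∈ Metric.ball 0 (√x)) :
      deriv (fun z => z * E z) z = E z * (1 - 2 / ν * t (z ^ 2)) := by
    rw [((hasDerivAt_id' z).fun_mul (hE' hz)).deriv]
    linear_combination E z * hzE hz
  have htd : DifferentiableAt ℂ t (z ^ 2) :=
    (negLogDeriv_differentiableOn hF hne).differentiableAt (Metric.isOpen_ball.mem_nhds
      (by simpa using norm_sq_lt_of_mem_ball_sqrt hx.le hz))
  have hG'' : HasDerivAt (deriv fun z => z * E z)
      (E z * (deriv F (z ^ 2) / F (z ^ 2) * (2 * z) / ν) * (1 - 2 / ν * t (z ^ 2)) +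
        E z * (-(2 / ν * (deriv t (z ^ 2) * (2 * z))))) z := by
    refine ((hE' hz).fun_mul (((hasDerivAt_comp_sq htd).const_mul (2 / (ν : ℂ))).const_sub
      1)).congr_of_eventuallyEq ?_
    filter_upwards [Metric.isOpen_ball.mem_nhds hz] with w hw using hG' hw
  have hEz : E z ≠ 0 := Complex.exp_ne_zero _
  have hpz := hp _ (norm_sq_lt_of_mem_ball_sqrt hx.le hz)
  rw [iteratedDeriv_succ, iteratedDeriv_one, hG''.deriv, hG' hz]
  refine ⟨mul_ne_zero hEz hpz, ?_⟩
  -- For `G = z E`, this is `z G'' = E (-(2/ν) t p - (4/ν) w t')` with `p = 1 - (2/ν) t` and `w =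
  -- z²`; division by `G' = E p` gives the functional.
  have e : z * (E z * (deriv F (z ^ 2) / F (z ^ 2) * (2 * z) / ν) * (1 - 2 / ν * t (z ^ 2)) +
      E z * (-(2 / ν * (deriv t (z ^ 2) * (2 * z))))) =
      E z * (-(2 / ν * t (z ^ 2)) * (1 - 2 / ν * t (z ^ 2)) - 4 / ν * eulerOp t (z ^ 2)) := by
    rw [← hzE hz, eulerOp]
    ring
  rw [e, mul_div_mul_left _ _ hEz, sub_div, mul_div_cancel_right₀ _ hpz]
  ring

/-- The left-hand side of the equation of `f_ν` in terms of the entire factor. -/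
theorem besselN_functional_eq (hν : 0 < ν) {r : ℝ} (hr : 0 < r)
    (h1 : besselNEntire a b c ν (r ^ 2) ≠ 0)
    (h2 : 1 - 2 / ν * negLogDeriv (besselNEntire a b c ν) (r ^ 2) ≠ 0) :
    1 + (r : ℂ) * iteratedDeriv 2 (besselN a b c ν) (r : ℂ)
          / deriv (besselN a b c ν) (r : ℂ)
        + (1 / (ν : ℂ) - 1)
          * ((r : ℂ) * deriv (besselN a b c ν) (r : ℂ) / besselN a b c ν (r : ℂ)) =
      1 - 2 / ν * negLogDeriv (besselNEntire a b c ν) (r ^ 2) -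
        4 / ν * eulerOp (negLogDeriv (besselNEntire a b c ν)) (r ^ 2) /
          (1 - 2 / ν * negLogDeriv (besselNEntire a b c ν) (r ^ 2)) := by
  have hν0 : (ν : ℂ) ≠ 0 := by exact_mod_cast hν.ne'
  have hr0 : (r : ℂ) ≠ 0 := by exact_mod_cast hr.ne'
  set P := besselNEntire a b c ν with hP
  have hPd : Differentiable ℂ P := besselNEntire_differentiable a b c ν
  set t := negLogDeriv P with ht
  have hC := two_cpow_inv_mul_cpow_ne_zero (ν := ν) hr
  have hL : laguerreOp ν P (r ^ 2) = ν * P (r ^ 2) * (1 - 2 / ν * t (r ^ 2)) := by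
    rw [laguerreOp_eq h1, ← ht]
    field_simp
  -- The Euler operator applied to the product `P (ν - 2t)`, valid near `r²` because `P` does not
  -- vanish there.
  have hELs : eulerOp (laguerreOp ν P) (r ^ 2) =
      -(t (r ^ 2) * P (r ^ 2)) * (ν - 2 * t (r ^ 2)) - 2 * P (r ^ 2) * eulerOp t (r ^ 2) := by
    have hne : ∀ᶠ w in 𝓝 ((r : ℂ) ^ 2), P w ≠ 0 := hPd.continuous.continuousAt.eventually_ne h1
    have htd : DifferentiableAt ℂ t (r ^ 2) :=
      ((hPd.eulerOp _).div (hPd _) h1).neg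
    have heq : laguerreOp ν P =ᶠ[𝓝 ((r : ℂ) ^ 2)] fun w => P w * (ν - 2 * t w) := by
      filter_upwards [hne] with w hw using laguerreOp_eq hw ν
    rw [(eulerOp_congr heq).eq_of_nhds, eulerOp_mul (hPd _) (by fun_prop), eulerOp_const_sub,
      eulerOp_const_mul, PosLogDeriv.eulerOp_eq_of_ne h1]
    ring
  have hd := mul_deriv_besselN_ofReal (a := a) (b := b) (c := c) (ν := ν) hr
  have hdd := sq_mul_deriv_besselN_ofReal (a := a) (b := b) (c := c) (ν := ν) hr
  have hn := besselN_ofReal (a := a) (b := b) (c := c) (ν := ν) hr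
  have e1 : (r : ℂ) * iteratedDeriv 2 (besselN a b c ν) r / deriv (besselN a b c ν) r =
      (r : ℂ) ^ 2 * iteratedDeriv 2 (besselN a b c ν) r / (r * deriv (besselN a b c ν) r) := by
    rw [sq, mul_assoc, mul_div_mul_left _ _ hr0]
  rw [e1, hdd, hd, hn, ← hP, mul_div_mul_left _ _ hC, mul_div_mul_left _ _ hC,
    show laguerreOp ν (laguerreOp ν P) (r ^ 2) =
      ν * laguerreOp ν P (r ^ 2) + 2 * eulerOp (laguerreOp ν P) (r ^ 2) from rfl, hELs, hL]
  generalize t (r ^ 2) = T at *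
  have h3 : (ν : ℂ) - 2 * T ≠ 0 := by
    intro h
    apply h2
    field_simp
    rw [h, mul_zero]
  generalize eulerOp t (r ^ 2) = D at *
  field_simp
  ring

theorem radiusOfConvexity_normF_isLeast (hP : PosLogDeriv (besselNEntire a b c ν))
    (hz : ∃ x : ℝ, 0 < x ∧ besselNEntire a b c ν x = 0) (hβ : β < 1)
    (hν : 0 < ν) (hQ : quadQ a b c ν ≠ 0) :
      IsLeast {r : ℝ | 0 < r ∧
          deriv (besselN a b c ν) (r : ℂ) ≠ 0 ∧ besselN a b c ν (r : ℂ) ≠ 0 ∧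
          1 + (r : ℂ) * iteratedDeriv 2 (besselN a b c ν) (r : ℂ)
                / deriv (besselN a b c ν) (r : ℂ)
            + (1 / (ν : ℂ) - 1)
                * ((r : ℂ) * deriv (besselN a b c ν) (r : ℂ) / besselN a b c ν (r : ℂ))
            = (β : ℂ)}
        (radiusOfConvexity β (normF a b c ν)) ∧
      ∃ l' l : ℝ,
        IsLeast {x : ℝ | 0 < x ∧ deriv (besselN a b c ν) (x : ℂ) = 0} l' ∧
        IsLeast {x : ℝ | 0 < x ∧ besselN a b c ν (x : ℂ) = 0} l ∧
        radiusOfConvexity β (normF a b c ν) < l' ∧ l' < l := by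
  have hν0 : (ν : ℂ) ≠ 0 := by exact_mod_cast hν.ne'
  obtain ⟨ρ, x, y, hρ, hρx, hxy, hne, hx, hp, hval, hlt⟩ := hP.exists_radius_rpow hβ hν
  have hx0 : 0 < x := hρ.trans hρx
  have hy0 : 0 < y := hx0.trans hxy
  have hK := normConst_mul_ne_zero hν.le hQ
  have hK0 : normConst a b c ν * ((2 : ℂ) ^ (ν : ℂ))⁻¹ * besselNEntire a b c ν 0 = 1 := by
    have h1 : (quadQ a b c ν : ℂ) ≠ 0 := by exact_mod_cast hQ
    have h2 := Gamma_ofReal_add_one_ne_zero hν.le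
    rw [normConst_mul, besselNEntire_zero]
    field_simp
  obtain ⟨l, hl0, hl⟩ := exists_log_on_ball (hP.const_mul hK).diff hK0 (y := x)
    fun w hw => mul_ne_zero hK (hne w (hw.trans hxy))
  have hT := negLogDeriv_const_mul hK (besselNEntire a b c ν)
  have hfun {z : ℂ} (hz : z ∈ Metric.ball 0 (√x)) := convexity_functional_exp (ν := ν) hx0
    (hP.const_mul hK).diff hν (fun w hw => mul_ne_zero hK (hne w (hw.trans hxy)))
    (fun w hw => (hl w hw).1) (by rw [hT]; exact hp) hz
  rw [hT] at hfun
  have hsq {r : ℝ} (hr : 0 < r) : ((√r : ℝ) : ℂ) ^ 2 = r := by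
    rw [← Complex.ofReal_pow, Real.sq_sqrt hr.le]
  have hρ' : 0 < √ρ := Real.sqrt_pos.2 hρ
  have hrad : radiusOfConvexity β (normF a b c ν) = √ρ := by
    refine radiusOfConvexity_eq hρ' (Real.sqrt_lt_sqrt hρ.le hρx) (normF_analytic hx0 hν
      (fun _ => rfl) hl0 fun w hw => ⟨(hl w hw).1.differentiableAt, (hl w hw).2⟩) ?_ ?_
    · intro z hz
      have h := hfun (Metric.ball_subset_ball (Real.sqrt_le_sqrt hρx.le) hz)
      refine ⟨h.1, ?_⟩
      rw [h.2]
      exact hlt _ (norm_sq_lt_of_mem_ball_sqrt hρ.le hz)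
    · rw [(hfun (by simpa [abs_of_pos hρ'] using Real.sqrt_lt_sqrt hρ.le hρx)).2, hsq hρ, hval,
        Complex.ofReal_re]
  -- `ν Φ + 2 E Φ = Φ (ν - 2t)`, and neither factor vanishes before `x`, where `t = ν/2` for the
  -- first time. So `√x` is the smallest positive zero of `N_ν'`.
  have hLne {r : ℝ} (hr : 0 < r) (hrx : r < √x) :
      laguerreOp ν (besselNEntire a b c ν) (r ^ 2) ≠ 0 := by
    have hb : ‖(r : ℂ) ^ 2‖ < x :=
      norm_sq_lt_of_mem_ball_sqrt hx0.le (by simpa [abs_of_pos hr] using hrx)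
    rw [laguerreOp_eq (hne _ (hb.trans hxy))]
    refine mul_ne_zero (hne _ (hb.trans hxy)) fun h => hp _ hb ?_
    field_simp
    rw [h, mul_zero]
  rw [hrad]
  refine ⟨⟨⟨hρ', ?_, ?_, ?_⟩, ?_⟩, √x, ?_⟩
  · rw [Ne, deriv_besselN_ofReal_eq_zero_iff hρ']
    exact hLne hρ' (Real.sqrt_lt_sqrt hρ.le hρx)
  · rw [Ne, besselN_ofReal_eq_zero_iff hρ', hsq hρ]
    exact hne _ (by simpa [abs_of_pos hρ] using hρx.trans hxy)
  · rw [besselN_functional_eq hν hρ', hsq hρ, hval]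
    · rw [hsq hρ]
      exact hne _ (by simpa [abs_of_pos hρ] using hρx.trans hxy)
    · rw [hsq hρ]
      exact hp _ (by simpa [abs_of_pos hρ] using hρx)
  · rintro r ⟨hr, _, _, h⟩
    by_contra! hrρ
    have hb : ‖(r : ℂ) ^ 2‖ < ρ :=
      norm_sq_lt_of_mem_ball_sqrt hρ.le (by simpa [abs_of_pos hr] using hrρ)
    rw [besselN_functional_eq hν hr (hne _ (hb.trans (hρx.trans hxy))) (hp _ (hb.trans hρx))] at h
    have h' := hlt _ hb
    rw [h, Complex.ofReal_re] at h'
    exact lt_irrefl _ h'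
  -- Allowing `s = 0` makes the set closed without adding a point, because `Φ(0) ≠ 0`.
  set S : Set ℝ := {s | 0 ≤ s ∧ besselNEntire a b c ν ((s : ℂ) ^ 2) = 0} with hS
  have hSc : IsClosed S := by
    refine isClosed_Ici.inter (isClosed_eq ?_ continuous_const)
    exact hP.diff.continuous.comp (by fun_prop)
  have hSn : S.Nonempty := by
    obtain ⟨s, hs, hs0⟩ := hz
    exact ⟨√s, Real.sqrt_nonneg s, by rw [hsq hs]; exact hs0⟩
  have hSb : BddBelow S := ⟨0, fun s hs => hs.1⟩
  have hSeq : {x : ℝ | 0 < x ∧ besselN a b c ν (x : ℂ) = 0} = S := by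
    ext s
    constructor
    · rintro ⟨h1, h2⟩
      exact ⟨h1.le, (besselN_ofReal_eq_zero_iff h1).1 h2⟩
    · rintro ⟨h1, h2⟩
      have h3 : 0 < s := by
        refine lt_of_le_of_ne h1 ?_
        rintro rfl
        apply hP.ne
        simpa using h2
      exact ⟨h3, (besselN_ofReal_eq_zero_iff h3).2 h2⟩
  refine ⟨sInf S, ⟨⟨Real.sqrt_pos.2 hx0, ?_⟩, ?_⟩, ?_, Real.sqrt_lt_sqrt hρ.le hρx, ?_⟩
  · rw [deriv_besselN_ofReal_eq_zero_iff (Real.sqrt_pos.2 hx0), hsq hx0,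
      laguerreOp_eq (hne _ (by simpa [abs_of_pos hx0] using hxy)), hx]
    push_cast
    ring
  · rintro r ⟨hr, h⟩
    by_contra! hrx
    exact hLne hr hrx ((deriv_besselN_ofReal_eq_zero_iff hr).1 h)
  · rw [hSeq]
    exact ⟨hSc.csInf_mem hSn hSb, fun s hs => csInf_le hSb hs⟩
  -- `Φ` has no zero in `‖w‖ < y` and `x < y`, so the first zero of `N_ν` lies strictly beyond `√x`.
  · have hmem := hSc.csInf_mem hSn hSb
    by_contra! hle
    refine hne _ (norm_sq_lt_of_mem_ball_sqrt hy0.le ?_) hmem.2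
    simpa [abs_of_nonneg hmem.1] using hle.trans_lt (Real.sqrt_lt_sqrt hx0.le hxy)

end

theorem theorem3 (a b c β ν : ℝ)
    (habc : (c = 0 ∧ a ≠ b) ∨ (0 < c ∧ a < b))
    (hβ : 0 ≤ β ∧ β < 1)
    (hν : 0 ≤ ν) (hν₀ : ∀ x : ℝ, quadQ a b c x = 0 → x ≤ ν)
    (hQ : quadQ a b c ν ≠ 0) :
    -- part (a)
    (ν ≠ 0 →
      IsLeast {r : ℝ | 0 < r ∧
          deriv (besselN a b c ν) (r : ℂ) ≠ 0 ∧ besselN a b c ν (r : ℂ) ≠ 0 ∧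
          1 + (r : ℂ) * iteratedDeriv 2 (besselN a b c ν) (r : ℂ)
                / deriv (besselN a b c ν) (r : ℂ)
            + (1 / (ν : ℂ) - 1)
                * ((r : ℂ) * deriv (besselN a b c ν) (r : ℂ) / besselN a b c ν (r : ℂ))
            = (β : ℂ)}
        (radiusOfConvexity β (normF a b c ν)) ∧
      ∃ l' l : ℝ,
        IsLeast {x : ℝ | 0 < x ∧ deriv (besselN a b c ν) (x : ℂ) = 0} l' ∧
        IsLeast {x : ℝ | 0 < x ∧ besselN a b c ν (x : ℂ) = 0} l ∧
        radiusOfConvexity β (normF a b c ν) < l' ∧ l' < l) ∧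
    -- part (b)
    IsLeast {r : ℝ | 0 < r ∧
        (r : ℂ) * deriv (besselN a b c ν) (r : ℂ)
          + (1 - (ν : ℂ)) * besselN a b c ν (r : ℂ) ≠ 0 ∧
        1 + ((r : ℂ) ^ 2 * iteratedDeriv 2 (besselN a b c ν) (r : ℂ)
              + (2 - 2 * (ν : ℂ)) * (r : ℂ) * deriv (besselN a b c ν) (r : ℂ)
              + ((ν : ℂ) ^ 2 - (ν : ℂ)) * besselN a b c ν (r : ℂ))
            / ((r : ℂ) * deriv (besselN a b c ν) (r : ℂ)
              + (1 - (ν : ℂ)) * besselN a b c ν (r : ℂ))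
          = (β : ℂ)}
      (radiusOfConvexity β (normG a b c ν)) ∧
    -- part (c)
    IsLeast {r : ℝ | 0 < r ∧
        2 * (√r : ℂ) * deriv (besselN a b c ν) (√r : ℂ)
          + 2 * (2 - (ν : ℂ)) * besselN a b c ν (√r : ℂ) ≠ 0 ∧
        1 + ((r : ℂ) * iteratedDeriv 2 (besselN a b c ν) (√r : ℂ)
              + (3 - 2 * (ν : ℂ)) * (√r : ℂ) * deriv (besselN a b c ν) (√r : ℂ)
              + ((ν : ℂ) ^ 2 - 2 * (ν : ℂ)) * besselN a b c ν (√r : ℂ))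
            / (2 * (√r : ℂ) * deriv (besselN a b c ν) (√r : ℂ)
              + 2 * (2 - (ν : ℂ)) * besselN a b c ν (√r : ℂ))
          = (β : ℂ)}
      (radiusOfConvexity β (normH a b c ν)) := by
  obtain ⟨hP, hz⟩ := besselNEntire_posLogDeriv habc hν hν₀ hQ
  exact ⟨fun h => radiusOfConvexity_normF_isLeast hP hz hβ.2 (lt_of_le_of_ne hν h.symm) hQ,
    radiusOfConvexity_normG_isLeast hP hβ.2 hν hQ, radiusOfConvexity_normH_isLeast hP hβ.2 hν hQ⟩
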